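/- Let $\mathcal V$ be a symmetric monoidal closed category whose underlying ordinary category is locally small, complete and cocomplete. "Category", "functor" and "natural" mean $\mathcal V$-category, $\mathcal V$-functor and $\mathcal V$-natural; a $\mathcal V$-category is small if its isomorphism classes of objects form a small set. A weight is a $\mathcal V$-functor $\varphi:\mathcal B^{op}\to\mathcal V$ with $\mathcal B$ small. For $T:\mathcal B^{op}\to\mathcal C$, the weighted limit $\{\varphi,T\}$ is an object of $\mathcal C$ with a $\mathcal V$-natural counit $\varphi\to\mathcal C(\{\varphi,T\},T-)$ that induces isomorphisms $\mathcal C(c,\{\varphi,T\})\cong[\mathcal B^{op},\mathcal V](\varphi,\mathcal C(c,T-))$ for all $c$; a $\mathcal V$-functor $P:\mathcal C\to\mathcal D$ preserves it if $P\{\varphi,T\}$, with counit the composite $\varphi\to\mathcal C(\{\varphi,T\},T-)\to\mathcal D(P\{\varphi,T\},PT-)$, is a limit of $PT$ weighted by $\varphi$. For $S:\mathcal B\to\mathcal C$, the weighted colimit $\varphi*S$ is the limit of $S^{op}:\mathcal B^{op}\to\mathcal C^{op}$ weighted by $\varphi$, and $P$ preserves it if $P^{op}$ preserves this limit. Theorem.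 For a weight $\varphi:\mathcal B^{op}\to\mathcal V$ the following are equivalent: (a) $\varphi$ is absolute for limits: for all $\mathcal V$-categories $\mathcal C,\mathcal D$ (not necessarily small) and all $T:\mathcal B^{op}\to\mathcal C$, the limit $\{\varphi,T\}$, whenever it exists, is preserved by every $\mathcal V$-functor $P:\mathcal C\to\mathcal D$; (b) $\varphi$ is absolute for colimits: for all $\mathcal V$-categories $\mathcal C,\mathcal D$ and all $S:\mathcal B\to\mathcal C$, the colimit $\varphi*S$, whenever it exists, is preserved by every $\mathcal V$-functor $P:\mathcal C\to\mathcal D$; (c) $\varphi$ is a small projective in $[\mathcal B^{op},\mathcal V]$: the representable $\mathcal V$-functor $[\mathcal B^{op},\mathcal V](\varphi,-):[\mathcal B^{op},\mathcal V]\to\mathcal V$ preserves all small colimits, i.e. every colimit $\psi*S$ with $\psi:\mathcal K^{op}\to\mathcal V$ a weight on a small $\mathcal V$-category $\mathcal K$ and $S:\mathcal K\to[\mathcal B^{op},\mathcal V]$. -/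

import Mathlib

open CategoryTheory MonoidalCategory Limits
open scoped MonoidalClosed

universe w v u t u₁ u₂ u₃

noncomputable section

namespace VCat

open BraidedCategory

/-! ### Natural families and the `V`-valued hom of functor categories -/

section NatFamily

variable {V : Type v} [Category.{w} V] [MonoidalCategory V] [SymmetricCategory V]
variable {K : Type u₁} [EnrichedCategory V K] {D : Type u₂} [EnrichedCategory V D]

/-- A family `X ⟶ D(F k, G k)`, `V`-natural in `k`. -/
@[ext]
structure NatFamily (X : V) (F G : EnrichedFunctor V K D) where
  app (k : K) : X ⟶ (F.obj k ⟶[V] G.obj k)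
  naturality (j k : K) :
    (app j ⊗ₘ G.map j k) ≫ eComp V (F.obj j) (G.obj j) (G.obj k) =
      (β_ X (j ⟶[V] k)).hom ≫ (F.map j k ⊗ₘ app k) ≫ eComp V (F.obj j) (F.obj k) (G.obj k)

/-- The family exhibits `E` as the end `∫ₖ D(F k, G k)`. -/
def NatFamily.IsUniversal {E : V} {F G : EnrichedFunctor V K D} (π : NatFamily E F G) : Prop :=
  ∀ (X : V) (σ : NatFamily X F G), ∃! f : X ⟶ E, ∀ k, f ≫ π.app k = σ.app k

/-- Reindexing of a natural family along `f : Y ⟶ X`. -/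
def NatFamily.precomp {X Y : V} {F G : EnrichedFunctor V K D} (f : Y ⟶ X) (σ : NatFamily X F G) :
    NatFamily Y F G where
  app k := f ≫ σ.app k
  naturality j k := by
    have h1 : (f ≫ σ.app j) ⊗ₘ G.map j k = f ▷ _ ≫ (σ.app j ⊗ₘ G.map j k) := by
      simp [MonoidalCategory.tensorHom_def]
    have h2 : F.map j k ⊗ₘ (f ≫ σ.app k) = _ ◁ f ≫ (F.map j k ⊗ₘ σ.app k) := by
      simp [MonoidalCategory.tensorHom_def']
    rw [h1, h2, Category.assoc, σ.naturality, braiding_naturality_left_assoc, Category.assoc]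

variable (V K) in
/-- A `V`-category is small when its isomorphism classes of objects form a small set. -/
class IsSmall : Prop where
  small_isoClasses : Small.{w} (_root_.Quotient (isIsomorphicSetoid (ForgetEnrichment V K)))

instance IsSmall.op [h : IsSmall V K] : IsSmall V Kᵒᵖ where
  small_isoClasses := by
    have := h.small_isoClasses
    let f : _root_.Quotient (isIsomorphicSetoid (ForgetEnrichment V K)) →
        _root_.Quotient (isIsomorphicSetoid (ForgetEnrichment V Kᵒᵖ)) :=
      Quotient.map (fun k ↦ (forgetEnrichmentOppositeEquivalence V K).inverse.obj (Opposite.op k))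
        (fun a b ⟨e⟩ ↦ ⟨(forgetEnrichmentOppositeEquivalence V K).inverse.mapIso e.symm.op⟩)
    exact small_of_surjective (f := f) (fun q ↦ by
      induction q using Quotient.inductionOn with
      | h x => exact ⟨Quotient.mk _ ((forgetEnrichmentOppositeEquivalence V K).functor.obj x).unop,
          rfl⟩)

end NatFamily

section Whisker

variable {V : Type v} [Category.{w} V] [MonoidalCategory V]
variable {C : Type u₁} [EnrichedCategory V C] {D : Type u₂} [EnrichedCategory V D]

/-- Composition `C(a, b) ⟶ C(a, c)` with an underlying morphism `b ⟶ c`. -/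
def post (a : C) {b c : C} (g : 𝟙_ V ⟶ (b ⟶[V] c)) : (a ⟶[V] b) ⟶ (a ⟶[V] c) :=
  (ρ_ _).inv ≫ _ ◁ g ≫ eComp V a b c

/-- Composition `C(b, c) ⟶ C(a, c)` with an underlying morphism `a ⟶ b`. -/
def pre {a b : C} (f : 𝟙_ V ⟶ (a ⟶[V] b)) (c : C) : (b ⟶[V] c) ⟶ (a ⟶[V] c) :=
  (λ_ _).inv ≫ f ▷ _ ≫ eComp V a b c

/-- `f` and `g` are mutually inverse morphisms of the underlying category. -/
structure Inv {a b : C} (f : 𝟙_ V ⟶ (a ⟶[V] b)) (g : 𝟙_ V ⟶ (b ⟶[V] a)) : Prop where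
  fg : (λ_ _).inv ≫ (f ⊗ₘ g) ≫ eComp V a b a = eId V a
  gf : (λ_ _).inv ≫ (g ⊗ₘ f) ≫ eComp V b a b = eId V b

theorem pre_post {a a' b b' : C} (f : 𝟙_ V ⟶ (a ⟶[V] a')) (g : 𝟙_ V ⟶ (b ⟶[V] b')) :
    post a' g ≫ pre f b' = pre f b ≫ post a g :=
  eHom_whisker_exchange V (C := ForgetEnrichment V C) (X := .of V a) (X' := .of V a')
    (Y := .of V b) (Y' := .of V b') (ForgetEnrichment.homOf V f) (ForgetEnrichment.homOf V g)

theorem comp_pre {a b : C} (f : 𝟙_ V ⟶ (a ⟶[V] b)) (c d : C) :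
    eComp V b c d ≫ pre f d = pre f c ▷ _ ≫ eComp V a c d :=
  eComp_eHomWhiskerRight V (C := ForgetEnrichment V C) (X := .of V a) (X' := .of V b)
    (ForgetEnrichment.homOf V f) (.of V c) (.of V d)

theorem comp_post (a b : C) {c d : C} (g : 𝟙_ V ⟶ (c ⟶[V] d)) :
    eComp V a b c ≫ post a g = _ ◁ post b g ≫ eComp V a b d :=
  eComp_eHomWhiskerLeft V (C := ForgetEnrichment V C) (.of V a) (.of V b) (Z := .of V c)
    (Z' := .of V d) (ForgetEnrichment.homOf V g)

theorem post_pre_comp (a : C) {b c : C} (g : 𝟙_ V ⟶ (b ⟶[V] c)) (d : C) :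
    post a g ▷ _ ≫ eComp V a c d = _ ◁ pre g d ≫ eComp V a b d := by
  simp only [post, pre, comp_whiskerRight, MonoidalCategory.whiskerLeft_comp, Category.assoc,
    ← e_assoc]
  simp

theorem Inv.post_comp {b c : C} {f : 𝟙_ V ⟶ (b ⟶[V] c)} {g : 𝟙_ V ⟶ (c ⟶[V] b)} (h : Inv f g)
    (a : C) : post a f ≫ post a g = 𝟙 _ := by
  have h1 := eHomWhiskerLeft_comp V (C := ForgetEnrichment V C) (.of V a) (Y := .of V b)
    (Y' := .of V c) (Y'' := .of V b) (ForgetEnrichment.homOf V f) (ForgetEnrichment.homOf V g)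
  rw [← ForgetEnrichment.homOf_comp, h.fg, ForgetEnrichment.homOf_eId, eHomWhiskerLeft_id] at h1
  exact h1.symm

theorem Inv.pre_comp {b c : C} {f : 𝟙_ V ⟶ (b ⟶[V] c)} {g : 𝟙_ V ⟶ (c ⟶[V] b)} (h : Inv f g)
    (a : C) : pre g a ≫ pre f a = 𝟙 _ := by
  have h1 := eHomWhiskerRight_comp V (C := ForgetEnrichment V C) (X := .of V b)
    (X' := .of V c) (X'' := .of V b) (ForgetEnrichment.homOf V f) (ForgetEnrichment.homOf V g)
    (.of V a)
  rw [← ForgetEnrichment.homOf_comp, h.fg, ForgetEnrichment.homOf_eId, eHomWhiskerRight_id] at h1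
  exact h1.symm

theorem map_post (F : EnrichedFunctor V C D) (a : C) {b c : C} (g : 𝟙_ V ⟶ (b ⟶[V] c)) :
    post a g ≫ F.map a c = F.map a b ≫ post (F.obj a) (g ≫ F.map b c) := by
  simp only [post, Category.assoc, F.map_comp, MonoidalCategory.tensorHom_def,
    MonoidalCategory.whiskerLeft_comp, rightUnitor_inv_naturality_assoc, whisker_exchange_assoc]

theorem map_pre (F : EnrichedFunctor V C D) {a b : C} (f : 𝟙_ V ⟶ (a ⟶[V] b)) (c : C) :
    pre f c ≫ F.map a c = F.map b c ≫ pre (f ≫ F.map a b) (F.obj c) := by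
  simp only [pre, Category.assoc, F.map_comp, MonoidalCategory.tensorHom_def',
    comp_whiskerRight, leftUnitor_inv_naturality_assoc, ← whisker_exchange_assoc]

theorem Inv.map {b c : C} {f : 𝟙_ V ⟶ (b ⟶[V] c)} {g : 𝟙_ V ⟶ (c ⟶[V] b)} (h : Inv f g)
    (F : EnrichedFunctor V C D) : Inv (f ≫ F.map b c) (g ≫ F.map c b) where
  fg := by
    rw [← tensorHom_comp_tensorHom_assoc, ← F.map_comp, ← F.map_id, ← h.fg]; simp
  gf := by
    rw [← tensorHom_comp_tensorHom_assoc, ← F.map_comp, ← F.map_id, ← h.gf]; simp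

variable (V) in
theorem exists_reps (K : Type u₁) [EnrichedCategory V K] [h : IsSmall V K] :
    ∃ (I : Type w) (rep : I → K) (idx : K → I), ∀ k, ∃ (e : 𝟙_ V ⟶ (k ⟶[V] rep (idx k)))
      (e' : 𝟙_ V ⟶ (rep (idx k) ⟶[V] k)), Inv e e' := by
  have := h.small_isoClasses
  let s := isIsomorphicSetoid (ForgetEnrichment V K)
  refine ⟨Shrink.{w} (_root_.Quotient s), fun i ↦ ForgetEnrichment.to V ((equivShrink _).symm i).out,
    fun k ↦ equivShrink _ (Quotient.mk s (ForgetEnrichment.of V k)), fun k ↦ ?_⟩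
  dsimp only
  rw [Equiv.symm_apply_apply]
  obtain ⟨e⟩ : IsIsomorphic (ForgetEnrichment.of V k) (Quotient.mk s (ForgetEnrichment.of V k)).out :=
    Setoid.symm (Quotient.mk_out (s := s) (ForgetEnrichment.of V k))
  refine ⟨ForgetEnrichment.homTo V e.hom, ForgetEnrichment.homTo V e.inv, ?_, ?_⟩
  · have h := congrArg (ForgetEnrichment.homTo V) e.hom_inv_id
    rw [ForgetEnrichment.homTo_id, ForgetEnrichment.homTo_comp, Category.assoc] at h
    exact h
  · have h := congrArg (ForgetEnrichment.homTo V) e.inv_hom_id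
    rw [ForgetEnrichment.homTo_id, ForgetEnrichment.homTo_comp, Category.assoc] at h
    exact h

end Whisker

section Ends

variable {V : Type v} [Category.{w} V] [MonoidalCategory V] [SymmetricCategory V]
variable {K : Type u₁} [EnrichedCategory V K] {D : Type u₂} [EnrichedCategory V D]

/-- A natural family is transported along an underlying morphism. -/
theorem app_post {X : V} {F G : EnrichedFunctor V K D} {j k : K}
    (a : X ⟶ (F.obj j ⟶[V] G.obj j)) (b : X ⟶ (F.obj k ⟶[V] G.obj k))
    (hab : (a ⊗ₘ G.map j k) ≫ eComp V _ _ _ =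
      (β_ X (j ⟶[V] k)).hom ≫ (F.map j k ⊗ₘ b) ≫ eComp V _ _ _)
    (e : 𝟙_ V ⟶ (j ⟶[V] k)) :
    a ≫ post (F.obj j) (e ≫ G.map j k) = b ≫ pre (e ≫ F.map j k) (G.obj k) := by
  have h := (ρ_ X).inv ≫= X ◁ e ≫= hab
  have h1 : a ≫ post (F.obj j) (e ≫ G.map j k) = (ρ_ X).inv ≫ X ◁ e ≫
      (a ⊗ₘ G.map j k) ≫ eComp V (F.obj j) (G.obj j) (G.obj k) := by
    simp only [post, rightUnitor_inv_naturality_assoc, MonoidalCategory.tensorHom_def,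
      MonoidalCategory.whiskerLeft_comp, Category.assoc, whisker_exchange_assoc]
  have h2 : b ≫ pre (e ≫ F.map j k) (G.obj k) = (ρ_ X).inv ≫ X ◁ e ≫
      (β_ X (j ⟶[V] k)).hom ≫ (F.map j k ⊗ₘ b) ≫ eComp V _ _ _ := by
    simp only [pre, leftUnitor_inv_naturality_assoc, MonoidalCategory.tensorHom_def',
      comp_whiskerRight, Category.assoc, ← whisker_exchange_assoc,
      braiding_naturality_right_assoc]
    simp
  rw [h1, h2, h]

/-- A family natural on representatives extends. -/
theorem extend_aux {X : V} {F G : EnrichedFunctor V K D} {j k j' k' : K}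
    {e : 𝟙_ V ⟶ (j ⟶[V] j')} {e' : 𝟙_ V ⟶ (j' ⟶[V] j)} (he : Inv e e')
    {d : 𝟙_ V ⟶ (k ⟶[V] k')} {d' : 𝟙_ V ⟶ (k' ⟶[V] k)} (hd : Inv d d')
    (a : X ⟶ (F.obj j' ⟶[V] G.obj j')) (b : X ⟶ (F.obj k' ⟶[V] G.obj k'))
    (h : (a ⊗ₘ G.map j' k') ≫ eComp V _ _ _ =
      (β_ X (j' ⟶[V] k')).hom ≫ (F.map j' k' ⊗ₘ b) ≫ eComp V _ _ _) :
    ((a ≫ pre (e ≫ F.map j j') _ ≫ post _ (e' ≫ G.map j' j)) ⊗ₘ G.map j k) ≫ eComp V _ _ _ =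
      (β_ X (j ⟶[V] k)).hom ≫
        (F.map j k ⊗ₘ (b ≫ pre (d ≫ F.map k k') _ ≫ post _ (d' ≫ G.map k' k))) ≫
          eComp V _ _ _ := by
  let t : (j ⟶[V] k) ⟶ (j' ⟶[V] k') := post j d ≫ pre e' k'
  have t1 : pre e' k = t ≫ post j' d' := by
    simp only [t, Category.assoc]
    rw [← pre_post, ← Category.assoc, hd.post_comp, Category.id_comp]
  have t2 : post j d = t ≫ pre e k' := by
    simp only [t, Category.assoc]
    rw [he.pre_comp, Category.comp_id]
  have l1 : G.map j k ≫ pre (e' ≫ G.map j' j) (G.obj k) =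
      t ≫ G.map j' k' ≫ post _ (d' ≫ G.map k' k) := by
    rw [← map_pre, t1, Category.assoc, map_post]
  have l2 : F.map j k ≫ post (F.obj j) (d ≫ F.map k k') =
      t ≫ F.map j' k' ≫ pre (e ≫ F.map j j') _ := by
    rw [← map_post, t2, Category.assoc, map_pre]
  have lhs : ((a ≫ pre (e ≫ F.map j j') _ ≫ post _ (e' ≫ G.map j' j)) ⊗ₘ G.map j k) ≫
      eComp V _ _ _ = X ◁ t ≫ ((a ⊗ₘ G.map j' k') ≫ eComp V _ _ _) ≫
        post _ (d' ≫ G.map k' k) ≫ pre (e ≫ F.map j j') _ := by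
    rw [MonoidalCategory.tensorHom_def', comp_whiskerRight, comp_whiskerRight]
    simp only [Category.assoc]
    rw [post_pre_comp, ← whisker_exchange_assoc, ← whisker_exchange_assoc,
      ← MonoidalCategory.whiskerLeft_comp_assoc, l1, ← comp_pre]
    simp only [MonoidalCategory.whiskerLeft_comp, Category.assoc, whisker_exchange_assoc,
      MonoidalCategory.tensorHom_def']
    rw [reassoc_of% (comp_post (F.obj j') (G.obj j') (d' ≫ G.map k' k))]
  have rhs : (F.map j k ⊗ₘ (b ≫ pre (d ≫ F.map k k') _ ≫ post _ (d' ≫ G.map k' k))) ≫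
          eComp V _ _ _ = t ▷ X ≫ ((F.map j' k' ⊗ₘ b) ≫ eComp V _ _ _) ≫
        pre (e ≫ F.map j j') _ ≫ post _ (d' ≫ G.map k' k) := by
    rw [MonoidalCategory.tensorHom_def, MonoidalCategory.whiskerLeft_comp,
      MonoidalCategory.whiskerLeft_comp]
    simp only [Category.assoc]
    rw [← comp_post, ← reassoc_of% (post_pre_comp (F.obj j) (d ≫ F.map k k')),
      whisker_exchange_assoc, ← comp_whiskerRight_assoc, l2]
    simp only [comp_whiskerRight, Category.assoc, ← whisker_exchange_assoc,
      MonoidalCategory.tensorHom_def]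
    rw [reassoc_of% (comp_pre (e ≫ F.map j j'))]
  rw [lhs, rhs, h]
  simp only [Category.assoc, braiding_naturality_right_assoc, pre_post]

theorem nat_iff [MonoidalClosed V] {X : V} {F G : EnrichedFunctor V K D} {j k : K}
    (a : X ⟶ (F.obj j ⟶[V] G.obj j)) (b : X ⟶ (F.obj k ⟶[V] G.obj k)) :
    (a ⊗ₘ G.map j k) ≫ eComp V _ _ _ =
      (β_ X (j ⟶[V] k)).hom ≫ (F.map j k ⊗ₘ b) ≫ eComp V _ _ _ ↔
    a ≫ MonoidalClosed.curry ((β_ _ _).hom ≫ _ ◁ G.map j k ≫ eComp V (F.obj j) (G.obj j) (G.obj k)) =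
      b ≫ MonoidalClosed.curry (F.map j k ▷ _ ≫ eComp V (F.obj j) (F.obj k) (G.obj k)) := by
  rw [← MonoidalClosed.curry_natural_left, ← MonoidalClosed.curry_natural_left,
    MonoidalClosed.curry_injective.eq_iff, ← cancel_epi (β_ (j ⟶[V] k) X).hom]
  simp only [MonoidalCategory.tensorHom_def, SymmetricCategory.symmetry_assoc, Category.assoc,
    braiding_naturality_right_assoc, whisker_exchange_assoc]

theorem exists_universal [MonoidalClosed V] [HasLimits V] [IsSmall V K]
    (F G : EnrichedFunctor V K D) :
    ∃ (E : V) (π : NatFamily E F G), π.IsUniversal := by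
  obtain ⟨I, rep, idx, h⟩ := exists_reps V K
  choose e e' he using h
  let P : V := ∏ᶜ fun i : I ↦ (F.obj (rep i) ⟶[V] G.obj (rep i))
  let Q : V := ∏ᶜ fun p : I × I ↦
    (ihom (rep p.1 ⟶[V] rep p.2)).obj (F.obj (rep p.1) ⟶[V] G.obj (rep p.2))
  let l : P ⟶ Q := Pi.lift fun p ↦ Pi.π _ p.1 ≫ MonoidalClosed.curry ((β_ _ _).hom ≫
    _ ◁ G.map (rep p.1) (rep p.2) ≫ eComp V (F.obj (rep p.1)) (G.obj (rep p.1)) (G.obj (rep p.2)))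
  let r : P ⟶ Q := Pi.lift fun p ↦ Pi.π _ p.2 ≫ MonoidalClosed.curry
    (F.map (rep p.1) (rep p.2) ▷ _ ≫ eComp V (F.obj (rep p.1)) (F.obj (rep p.2)) (G.obj (rep p.2)))
  let q (i : I) : equalizer l r ⟶ (F.obj (rep i) ⟶[V] G.obj (rep i)) :=
    equalizer.ι l r ≫ Pi.π _ i
  have hq (i j : I) := (nat_iff (F := F) (G := G) (q i) (q j)).2 (by
    have := equalizer.condition l r =≫ Pi.π _ (i, j)
    simpa [l, r, q] using this)
  have hq' (i : I) := hq i (idx (rep i))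
  have hs {X : V} (σ : NatFamily X F G) (k : K) : σ.app k =
      σ.app (rep (idx k)) ≫ pre (e k ≫ F.map _ _) _ ≫ post _ (e' k ≫ G.map _ _) := by
    rw [← Category.assoc, ← app_post _ _ (σ.naturality _ _), Category.assoc, ((he k).map G).post_comp, Category.comp_id]
  refine ⟨equalizer l r, ⟨fun k ↦ q (idx k) ≫ pre (e k ≫ F.map _ _) _ ≫
    post _ (e' k ≫ G.map _ _), fun j k ↦ extend_aux (he j) (he k) _ _ (hq _ _)⟩, fun X σ ↦ ?_⟩
  refine ⟨equalizer.lift (Pi.lift fun i ↦ σ.app (rep i)) ?_, ?_, ?_⟩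
  · refine Pi.hom_ext _ _ fun p ↦ ?_
    have := (nat_iff _ _).1 (σ.naturality (rep p.1) (rep p.2))
    simpa [l, r] using this
  · intro k
    dsimp only
    rw [hs σ k]
    simp [q]
  · intro f hf
    refine equalizer.hom_ext (Pi.hom_ext _ _ fun i ↦ ?_)
    have h1 := hf (rep i)
    dsimp only at h1
    rw [← reassoc_of% (app_post _ _ (hq' i) (e (rep i))), ((he _).map G).post_comp,
      Category.comp_id] at h1
    simp [← h1, q]

end Ends

section FunctorCategory

variable {V : Type v} [Category.{w} V] [MonoidalCategory V]
variable {K : Type u₁} [EnrichedCategory V K] {D : Type u₂} [EnrichedCategory V D]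

theorem star_assoc {X Y Z : V} {a b c d : D} (f : X ⟶ (a ⟶[V] b)) (g : Y ⟶ (b ⟶[V] c))
    (h : Z ⟶ (c ⟶[V] d)) :
    (((f ⊗ₘ g) ≫ eComp V a b c) ⊗ₘ h) ≫ eComp V a c d =
      (α_ X Y Z).hom ≫ (f ⊗ₘ ((g ⊗ₘ h) ≫ eComp V b c d)) ≫ eComp V a b d := by
  have e1 : ((f ⊗ₘ g) ≫ eComp V a b c) ⊗ₘ h = ((f ⊗ₘ g) ⊗ₘ h) ≫ eComp V a b c ▷ _ := by
    rw [← tensorHom_id, tensorHom_comp_tensorHom, Category.comp_id]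
  have e2 : f ⊗ₘ ((g ⊗ₘ h) ≫ eComp V b c d) = (f ⊗ₘ (g ⊗ₘ h)) ≫ _ ◁ eComp V b c d := by
    rw [← id_tensorHom, tensorHom_comp_tensorHom, Category.comp_id]
  rw [e1, e2, Category.assoc, Category.assoc, ← e_assoc', associator_naturality_assoc]

theorem star_left {X X' Y : V} {a b c : D} (u : X' ⟶ X) (f : X ⟶ (a ⟶[V] b))
    (g : Y ⟶ (b ⟶[V] c)) :
    ((u ≫ f) ⊗ₘ g) ≫ eComp V a b c = u ▷ Y ≫ (f ⊗ₘ g) ≫ eComp V a b c := by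
  simp [MonoidalCategory.tensorHom_def]

theorem star_right {X Y Y' : V} {a b c : D} (u : Y' ⟶ Y) (f : X ⟶ (a ⟶[V] b))
    (g : Y ⟶ (b ⟶[V] c)) :
    (f ⊗ₘ (u ≫ g)) ≫ eComp V a b c = X ◁ u ≫ (f ⊗ₘ g) ≫ eComp V a b c := by
  simp [MonoidalCategory.tensorHom_def']

theorem star_id {X : V} {a b : D} (f : X ⟶ (a ⟶[V] b)) :
    (f ⊗ₘ eId V b) ≫ eComp V a b b = (ρ_ X).hom ≫ f := by
  rw [← cancel_epi (ρ_ X).inv, MonoidalCategory.tensorHom_def, Category.assoc,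
    ← rightUnitor_inv_naturality_assoc, e_comp_id]
  simp

theorem id_star {X : V} {a b : D} (f : X ⟶ (a ⟶[V] b)) :
    (eId V a ⊗ₘ f) ≫ eComp V a a b = (λ_ X).hom ≫ f := by
  rw [← cancel_epi (λ_ X).inv, MonoidalCategory.tensorHom_def', Category.assoc,
    ← leftUnitor_inv_naturality_assoc, e_id_comp]
  simp

variable [SymmetricCategory V]

/-- The identity family. -/
def NatFamily.id (F : EnrichedFunctor V K D) : NatFamily (𝟙_ V) F F where
  app k := eId V (F.obj k)
  naturality j k := by rw [id_star, star_id]; simp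

/-- Composition of natural families. -/
def NatFamily.comp {X Y : V} {F G H : EnrichedFunctor V K D} (σ : NatFamily X F G)
    (τ : NatFamily Y G H) : NatFamily (X ⊗ Y) F H where
  app k := (σ.app k ⊗ₘ τ.app k) ≫ eComp V (F.obj k) (G.obj k) (H.obj k)
  naturality j k := by
    have h : (σ.app j ⊗ₘ (G.map j k ⊗ₘ τ.app k) ≫ eComp V _ _ _) ≫ eComp V _ _ _ =
        (α_ _ _ _).inv ≫ (β_ X (j ⟶[V] k)).hom ▷ Y ≫ (α_ _ _ _).hom ≫
          (F.map j k ⊗ₘ (σ.app k ⊗ₘ τ.app k) ≫ eComp V _ _ _) ≫ eComp V _ _ _ := by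
      rw [← star_assoc, ← star_left, ← σ.naturality, star_assoc, Iso.inv_hom_id_assoc]
    rw [star_assoc, τ.naturality, star_right, h, braiding_tensor_left_hom]
    simp only [Category.assoc]

variable [MonoidalClosed V] [HasLimits V] [IsSmall V K]

/-- The hom-object `[K, D](F, G) = ∫ₖ D(F k, G k)` in `V`. -/
def natHom (F G : EnrichedFunctor V K D) : V := (exists_universal F G).choose

/-- The projections of the end `[K, D](F, G)`. -/
def natHomπ (F G : EnrichedFunctor V K D) : NatFamily (natHom F G) F G :=
  (exists_universal F G).choose_spec.choose

theorem natHomπ_isUniversal (F G : EnrichedFunctor V K D) : (natHomπ F G).IsUniversal :=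
  (exists_universal F G).choose_spec.choose_spec

/-- The morphism into the end `[K, D](F, G)` given by a natural family. -/
def NatFamily.lift {X : V} {F G : EnrichedFunctor V K D} (σ : NatFamily X F G) : X ⟶ natHom F G :=
  (natHomπ_isUniversal F G X σ).choose

@[simp]
theorem NatFamily.lift_π {X : V} {F G : EnrichedFunctor V K D} (σ : NatFamily X F G) (k : K) :
    σ.lift ≫ (natHomπ F G).app k = σ.app k :=
  (natHomπ_isUniversal F G X σ).choose_spec.1 k

theorem natHom_ext {X : V} {F G : EnrichedFunctor V K D} {f g : X ⟶ natHom F G}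
    (h : ∀ k, f ≫ (natHomπ F G).app k = g ≫ (natHomπ F G).app k) : f = g :=
  (natHomπ_isUniversal F G X ((natHomπ F G).precomp g)).unique h (fun _ ↦ rfl)

/-- The functor `V`-category `[K, D]` for small `K`: objects are `V`-functors and the hom-objects
are the ends `∫ₖ D(F k, G k)`. -/
instance functorCategory : EnrichedCategory V (EnrichedFunctor V K D) where
  Hom F G := natHom F G
  id F := (NatFamily.id F).lift
  comp F G H := ((natHomπ F G).comp (natHomπ G H)).lift
  id_comp F G := natHom_ext fun k ↦ by
    simp only [Category.assoc, NatFamily.lift_π, Category.id_comp]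
    dsimp only [NatFamily.comp]
    rw [← star_left, NatFamily.lift_π]
    dsimp only [NatFamily.id]
    rw [id_star, Iso.inv_hom_id_assoc]
  comp_id F G := natHom_ext fun k ↦ by
    simp only [Category.assoc, NatFamily.lift_π, Category.id_comp]
    dsimp only [NatFamily.comp]
    rw [← star_right, NatFamily.lift_π]
    dsimp only [NatFamily.id]
    rw [star_id, Iso.inv_hom_id_assoc]
  assoc F G H L := natHom_ext fun k ↦ by
    simp only [Category.assoc, NatFamily.lift_π]
    dsimp only [NatFamily.comp]
    rw [← star_left, ← star_right, NatFamily.lift_π, NatFamily.lift_π]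
    dsimp only [NatFamily.comp]
    rw [star_assoc, Iso.inv_hom_id_assoc]

end FunctorCategory

section Coyoneda

variable {V : Type v} [Category.{w} V] [MonoidalCategory V] [MonoidalClosed V]
variable {C : Type u₁} [EnrichedCategory V C]

theorem tensorHom_self_comp {X Y a b c : V} (f : X ⟶ (ihom a).obj b) (g : Y ⟶ (ihom b).obj c) :
    (f ⊗ₘ g) ≫ eComp V a b c = MonoidalClosed.curry
      ((α_ a X Y).inv ≫ MonoidalClosed.uncurry f ▷ Y ≫ MonoidalClosed.uncurry g) := by
  change (f ⊗ₘ g) ≫ MonoidalClosed.curry (MonoidalClosed.compTranspose a b c) = _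
  rw [← MonoidalClosed.curry_natural_left, MonoidalClosed.compTranspose_eq,
    MonoidalClosed.uncurry_eq, MonoidalClosed.uncurry_eq]
  congr 1
  have h : (a ⊗ (ihom a).obj b) ◁ g ≫ (ihom.ev a).app b ▷ (ihom b).obj c =
    (ihom.ev a).app b ▷ Y ≫ b ◁ g := whisker_exchange ((ihom.ev a).app b) g
  rw [MonoidalCategory.tensorHom_def, MonoidalCategory.whiskerLeft_comp, Category.assoc,
    associator_inv_naturality_right_assoc, associator_inv_naturality_middle_assoc, reassoc_of% h,
    comp_whiskerRight, Category.assoc]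

variable (V) in
/-- The representable `V`-functor `C(a, -) : C ⟶ V`. -/
abbrev coyo (a : C) : EnrichedFunctor V C V where
  obj x := a ⟶[V] x
  map x y := MonoidalClosed.curry (eComp V a x y)
  map_id x := by
    rw [← MonoidalClosed.curry_natural_left]
    change _ = MonoidalClosed.curry _
    congr 1
    rw [← cancel_epi (ρ_ (a ⟶[V] x)).inv, e_comp_id]; simp
  map_comp x y z := by
    refine Eq.trans ?_ (tensorHom_self_comp _ _).symm
    rw [← MonoidalClosed.curry_natural_left, MonoidalClosed.uncurry_curry,
      MonoidalClosed.uncurry_curry, e_assoc]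

variable {K : Type u₂} [EnrichedCategory V K]

/-- The `V`-functor `C(a, T -) : K ⟶ V`, the composite of `T` and `C(a, -)`. -/
abbrev coyoComp (a : C) (T : EnrichedFunctor V K C) : EnrichedFunctor V K V where
  obj k := a ⟶[V] T.obj k
  map j k := T.map j k ≫ MonoidalClosed.curry (eComp V a (T.obj j) (T.obj k))
  map_id := (T.comp V (coyo V a)).map_id
  map_comp := (T.comp V (coyo V a)).map_comp

end Coyoneda

section Op

variable {V : Type v} [Category.{w} V] [MonoidalCategory V] [SymmetricCategory V]
variable {C : Type u₁} [EnrichedCategory V C] {D : Type u₂} [EnrichedCategory V D]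

/-- The opposite `V`-functor. -/
def opFunctor (F : EnrichedFunctor V C D) : EnrichedFunctor V Cᵒᵖ Dᵒᵖ where
  obj x := Opposite.op (F.obj x.unop)
  map x y := F.map y.unop x.unop
  map_id x := F.map_id x.unop
  map_comp x y z := by
    rw [tensorHom_eComp_op_eq, eComp_op_eq, Category.assoc]
    exact congrArg (_ ≫ ·) (F.map_comp _ _ _)

theorem swap_aux {A B X Y Z P Q R S : V} (u : A ⊗ B ⟶ S) (f : A ⟶ P) (t : B ⟶ Q)
    (g : S ⟶ R) (m : P ⊗ Q ⟶ R) (h : u ≫ g = (f ⊗ₘ t) ≫ m)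
    (n : X ⊗ R ⟶ Z) (r : X ⊗ P ⟶ Y) (q : Y ⊗ Q ⟶ Z)
    (hn : (α_ _ _ _).inv ≫ r ▷ Q ≫ q = X ◁ m ≫ n) :
    (α_ A X B).inv ≫ ((β_ A X).hom ≫ X ◁ f ≫ r) ▷ B ≫ Y ◁ t ≫ q =
      A ◁ (β_ X B).hom ≫ (α_ A B X).inv ≫ u ▷ X ≫ (β_ S X).hom ≫ X ◁ g ≫ n := by
  have e1 : (u ▷ X ≫ (β_ S X).hom ≫ X ◁ g ≫ n) =
      (β_ (A ⊗ B) X).hom ≫ X ◁ (f ⊗ₘ t) ≫ (α_ _ _ _).inv ≫ r ▷ Q ≫ q := by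
    rw [braiding_naturality_left_assoc, ← MonoidalCategory.whiskerLeft_comp_assoc, h,
      MonoidalCategory.whiskerLeft_comp_assoc, hn]
  rw [e1]
  simp only [braiding_tensor_left_hom, Category.assoc, Iso.inv_hom_id_assoc,
    ← MonoidalCategory.whiskerLeft_comp_assoc, SymmetricCategory.symmetry]
  simp only [MonoidalCategory.tensorHom_def, MonoidalCategory.whiskerLeft_comp, comp_whiskerRight,
    Category.assoc, associator_inv_naturality_middle_assoc, associator_inv_naturality_right_assoc,
    MonoidalCategory.whiskerLeft_id, Category.id_comp, Iso.hom_inv_id_assoc]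
  rw [whisker_exchange_assoc]

end Op

section Weighted

variable {V : Type v} [Category.{w} V] [MonoidalCategory V] [SymmetricCategory V] [MonoidalClosed V]
variable {K : Type u₁} [EnrichedCategory V K] {C : Type u₂} [EnrichedCategory V C]
  {D : Type u₃} [EnrichedCategory V D]

/-- An object `pt` of `C` with a `V`-natural transformation `φ ⟶ C(pt, T -)`; the square
expressing `V`-naturality is transposed to one of maps `φ j ⊗ K(j, k) ⟶ C(pt, T k)`. -/
structure WeightedCone (φ : EnrichedFunctor V K V) (T : EnrichedFunctor V K C) where
  pt : C
  counit (k : K) : φ.obj k ⟶ (pt ⟶[V] T.obj k)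
  naturality (j k : K) :
    MonoidalClosed.uncurry (φ.map j k) ≫ counit k =
      (counit j ⊗ₘ T.map j k) ≫ eComp V pt (T.obj j) (T.obj k)

/-- The image of a weighted cone under a `V`-functor `P`: its counit is the composite
`φ ⟶ C(pt, T -) ⟶ D(P pt, P T -)`. -/
def WeightedCone.map {φ : EnrichedFunctor V K V} {T : EnrichedFunctor V K C}
    (c : WeightedCone φ T) (P : EnrichedFunctor V C D) : WeightedCone φ (T.comp V P) where
  pt := P.obj c.pt
  counit k := c.counit k ≫ P.map c.pt (T.obj k)
  naturality j k := by
    have h := c.naturality j k =≫ P.map c.pt (T.obj k)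
    rw [Category.assoc, Category.assoc, P.map_comp, tensorHom_comp_tensorHom_assoc] at h
    exact h

/-- The family `C(a, pt) ⟶ [φ k, C(a, T k)]` induced by the counit of a cone. -/
def WeightedCone.family {φ : EnrichedFunctor V K V} {T : EnrichedFunctor V K C}
    (c : WeightedCone φ T) (a : C) :
    NatFamily (a ⟶[V] c.pt) φ (coyoComp a T) where
  app k := MonoidalClosed.curry
    ((β_ _ _).hom ≫ (a ⟶[V] c.pt) ◁ c.counit k ≫ eComp V a c.pt (T.obj k))
  naturality j k := by
    refine (tensorHom_self_comp _ _).trans (Eq.trans ?_ (congrArg (_ ≫ ·)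
      (tensorHom_self_comp _ _)).symm)
    rw [← MonoidalClosed.curry_natural_left, MonoidalClosed.uncurry_curry,
      MonoidalClosed.uncurry_curry]
    congr 1
    change _ ≫ _ ≫ MonoidalClosed.uncurry (T.map j k ≫ MonoidalClosed.curry (eComp V a _ _)) = _
    rw [MonoidalClosed.uncurry_natural_left, MonoidalClosed.uncurry_curry]
    exact swap_aux (MonoidalClosed.uncurry (φ.map j k)) (c.counit j) (T.map j k) (c.counit k)
      (eComp V c.pt (T.obj j) (T.obj k)) (c.naturality j k) (eComp V a c.pt (T.obj k))
      (eComp V a c.pt (T.obj j)) (eComp V a (T.obj j) (T.obj k)) (e_assoc V _ _ _ _)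

/-- The canonical comparison `C(a, pt) ⟶ [K, V](φ, C(a, T -))`. -/
def WeightedCone.comparison [HasLimits V] [IsSmall V K] {φ : EnrichedFunctor V K V}
    {T : EnrichedFunctor V K C} (c : WeightedCone φ T) (a : C) :
    (a ⟶[V] c.pt) ⟶ (φ ⟶[V] coyoComp a T) :=
  (c.family a).lift

/-- The cone exhibits `pt` as the weighted limit `{φ, T}`, i.e. its counit induces isomorphisms
`C(a, pt) ≅ [K, V](φ, C(a, T -))`. -/
def WeightedCone.IsLimit [HasLimits V] [IsSmall V K] {φ : EnrichedFunctor V K V}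
    {T : EnrichedFunctor V K C} (c : WeightedCone φ T) : Prop :=
  ∀ a : C, IsIso (c.comparison a)

/-- `P` preserves the limit `{φ, T}` (if it exists). -/
def PreservesLimit [HasLimits V] [IsSmall V K] (φ : EnrichedFunctor V K V)
    (T : EnrichedFunctor V K C) (P : EnrichedFunctor V C D) : Prop :=
  ∀ c : WeightedCone φ T, c.IsLimit → (c.map P).IsLimit

/-- `P` preserves the colimit `φ * S` (if it exists); this colimit is the limit of `Sᵒᵖ` in `Cᵒᵖ`
weighted by `φ`, and `P` preserves it when `Pᵒᵖ` preserves that limit. -/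
def PreservesColimit [HasLimits V] [IsSmall V K] (φ : EnrichedFunctor V Kᵒᵖ V)
    (S : EnrichedFunctor V K C) (P : EnrichedFunctor V C D) : Prop :=
  PreservesLimit φ (opFunctor S) (opFunctor P)

end Weighted

section Weights

variable {V : Type v} [Category.{w} V] [MonoidalCategory V] [SymmetricCategory V] [MonoidalClosed V]
  [HasLimits V] {B : Type u} [EnrichedCategory V B] [IsSmall V B]

/-- Every limit `{φ, T}` in a `V`-category `C` is preserved by every `V`-functor `C ⟶ D`. Here
`C` and `D` range over the `V`-categories, small or not, with objects in a universe `u₁`. -/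
def IsAbsoluteForLimits (φ : EnrichedFunctor V Bᵒᵖ V) : Prop :=
  ∀ (C D : Type u₁) [EnrichedCategory V C] [EnrichedCategory V D]
    (T : EnrichedFunctor V Bᵒᵖ C) (P : EnrichedFunctor V C D), PreservesLimit φ T P

/-- Every colimit `φ * S` in a `V`-category `C` is preserved by every `V`-functor `C ⟶ D`. Here
`C` and `D` range over the `V`-categories, small or not, with objects in a universe `u₁`. -/
def IsAbsoluteForColimits (φ : EnrichedFunctor V Bᵒᵖ V) : Prop :=
  ∀ (C D : Type u₁) [EnrichedCategory V C] [EnrichedCategory V D]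
    (S : EnrichedFunctor V B C) (P : EnrichedFunctor V C D), PreservesColimit φ S P

/-- The representable `V`-functor `[Bᵒᵖ, V](φ, -) : [Bᵒᵖ, V] ⟶ V` preserves all small colimits,
that is, all colimits `ψ * S` with `ψ` a weight on a small `V`-category `K`. -/
def IsSmallProjective (φ : EnrichedFunctor V Bᵒᵖ V) : Prop :=
  ∀ (K : Type u) [EnrichedCategory V K] [IsSmall V K] (ψ : EnrichedFunctor V Kᵒᵖ V)
    (S : EnrichedFunctor V K (EnrichedFunctor V Bᵒᵖ V)), PreservesColimit ψ S (coyo V φ)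

end Weights

end VCat

end

/-! Put A = Bᵒᵖ and regard a V-functor F : A ⟶ V as a right module, with action F j ⊗ A(j, k) ⟶ F k.
Write φ♯ b = [A, V](φ, A(b, -)) for the dual of φ. Everything passes through one condition,
`IsNuclear φ`: the compositions φ b ⊗ φ♯ b ⟶ [A, V](φ, φ) form a coend, stably under X ⊗ -. It plays
the role of the dual basis lemma for finitely generated projective modules: a map out of X ⊗ [A,
V](φ, φ) may be defined on products x · f, and then evaluated at the identity of φ.

Nuclearity is necessary. By Yoneda, φ is the colimit φ * Y of the Yoneda embedding Y
(`yonedaCone_isLimit`), and nuclearity says exactly that [A, V](φ, -) preserves this colimit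
(`isNuclear_of_preservesColimit`). This is one instance both of absoluteness for colimits and of
small projectivity.

Nuclearity is sufficient. Every limit cone carries maps φ♯ b ⟶ C(T b, pt) subject to equations
(`WeightedCone.IsLimit.isSplit`). All V-functors preserve these equations
(`WeightedCone.IsSplit.map`), and for nuclear φ they force a cone to be a limit
(`IsNuclear.isLimit`). Hence φ is absolute for limits and, by passing to opposites, for colimits.
For small projectivity, [A, V](φ, -) behaves as a left adjoint: its right adjoint is Y ↦ [φ♯ -, Y]
(`IsNuclear.preservesColimit`). -/

noncomputable section

namespace VCat

open BraidedCategory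

/-! ### Multiplications in context and evaluation on the right -/

section Context

variable {V : Type v} [Category.{w} V] [MonoidalCategory V]

/-- The morphism `f : A ⊗ B ⟶ C` applied to the last two factors of `X ⊗ A ⊗ B`. -/
def inCtx (X : V) {A B C : V} (f : A ⊗ B ⟶ C) : (X ⊗ A) ⊗ B ⟶ X ⊗ C :=
  (α_ X A B).hom ≫ X ◁ f

theorem inCtx_naturality {X Y A B C : V} (h : X ⟶ Y) (f : A ⊗ B ⟶ C) :
    h ▷ A ▷ B ≫ inCtx Y f = inCtx X f ≫ h ▷ C := by
  simp [inCtx, whisker_exchange]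

theorem inCtx_whiskerLeft (X : V) {A A' B C : V} (g : A' ⟶ A) (f : A ⊗ B ⟶ C) :
    (X ◁ g) ▷ B ≫ inCtx X f = inCtx X (g ▷ B ≫ f) := by
  simp [inCtx]

theorem inCtx_whiskerRight (X : V) {A B B' C : V} (g : B' ⟶ B) (f : A ⊗ B ⟶ C) :
    (X ⊗ A) ◁ g ≫ inCtx X f = inCtx X (A ◁ g ≫ f) := by
  simp [inCtx]

theorem inCtx_comp (X : V) {A B C C' : V} (f : A ⊗ B ⟶ C) (g : C ⟶ C') :
    inCtx X (f ≫ g) = inCtx X f ≫ X ◁ g := by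
  simp [inCtx]

/-- The hypothesis reads (ab)c = a(bc) for four multiplications. Keeping such laws under an extra
left factor lets the module computations below run as if on elements. -/
theorem inCtx_assoc (X : V) {A B C P Q R : V} {p : A ⊗ B ⟶ P} {q : P ⊗ C ⟶ Q} {r : B ⊗ C ⟶ R}
    {s : A ⊗ R ⟶ Q} (h : p ▷ C ≫ q = inCtx A r ≫ s) :
    inCtx X p ▷ C ≫ inCtx X q = inCtx (X ⊗ A) r ≫ inCtx X s := by
  have h' := congrArg (fun f ↦ (α_ X (A ⊗ B) C).hom ≫ X ◁ f) h
  simp only [inCtx, comp_whiskerRight, Category.assoc, MonoidalCategory.whiskerLeft_comp] at h' ⊢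
  rw [associator_naturality_middle_assoc, h']
  simp

theorem inCtx_unit {X A B : V} (f : 𝟙_ V ⊗ A ⟶ B) :
    (ρ_ X).inv ▷ A ≫ inCtx X f = X ◁ ((λ_ A).inv ≫ f) := by
  simp [inCtx]

variable {C : Type u₁} [EnrichedCategory V C]

theorem eComp_eComp (a b c d : C) :
    eComp V a b c ▷ _ ≫ eComp V a c d = inCtx _ (eComp V b c d) ≫ eComp V a b d := by
  rw [inCtx, Category.assoc, e_assoc']

end Context

section LeftEval

variable {V : Type v} [Category.{w} V] [MonoidalCategory V] [SymmetricCategory V] [MonoidalClosed V]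

/-- Evaluation `[a, b] ⊗ a ⟶ b`. -/
def lev (a b : V) : (EnrichedCategory.Hom a b : V) ⊗ a ⟶ b := (β_ _ _).hom ≫ (ihom.ev a).app b

theorem whiskerRight_lev {X a b : V} (f : X ⟶ (EnrichedCategory.Hom a b : V)) :
    f ▷ a ≫ lev a b = (β_ X a).hom ≫ MonoidalClosed.uncurry f := by
  rw [lev, MonoidalClosed.uncurry_eq, braiding_naturality_left_assoc]

/-- The transpose `X ⟶ [a, b]` of a morphism `X ⊗ a ⟶ b`. -/
def lcurry {X a b : V} (f : X ⊗ a ⟶ b) : X ⟶ (EnrichedCategory.Hom a b : V) :=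
  MonoidalClosed.curry ((β_ a X).hom ≫ f)

@[simp]
theorem lcurry_lev {X a b : V} (f : X ⊗ a ⟶ b) : lcurry f ▷ a ≫ lev a b = f := by
  rw [whiskerRight_lev, lcurry, MonoidalClosed.uncurry_curry, SymmetricCategory.symmetry_assoc]

theorem lev_ext {X a b : V} {f g : X ⟶ (EnrichedCategory.Hom a b : V)}
    (h : f ▷ a ≫ lev a b = g ▷ a ≫ lev a b) :
    f = g := by
  rw [whiskerRight_lev, whiskerRight_lev, cancel_epi] at h
  exact MonoidalClosed.uncurry_injective h

-- The braidings return P, Q, a to their original order, so by symmetric coherence only the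
-- associator remains.
omit [MonoidalClosed V] in
theorem braiding_reverse (P Q a : V) :
    (β_ (P ⊗ Q) a).hom ≫ a ◁ (β_ P Q).hom ≫ (α_ a Q P).inv ≫ (β_ (a ⊗ Q) P).hom ≫
      P ◁ (β_ a Q).hom = (α_ P Q a).hom := by
  have h : (β_ P Q).hom ▷ a ≫ (α_ _ _ _).hom ≫ _ ◁ (β_ P a).hom ≫ (α_ _ _ _).inv =
      (α_ _ _ _).hom ≫ (β_ P (Q ⊗ a)).hom := by
    rw [braiding_tensor_right_hom, Iso.hom_inv_id_assoc]
  rw [← braiding_naturality_left_assoc, braiding_tensor_left_hom]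
  simp only [Category.assoc, Iso.hom_inv_id_assoc]
  rw [braiding_naturality_left_assoc, reassoc_of% h, SymmetricCategory.symmetry_assoc,
    ← MonoidalCategory.whiskerLeft_comp, SymmetricCategory.symmetry]
  simp

/-- This is (g ∘ f)(x) = g(f(x)). `eComp` is in diagrammatic order; the braiding restores the order
that suits an argument written on the right. -/
theorem eComp_lev (a b c : V) :
    ((β_ (EnrichedCategory.Hom b c : V) (EnrichedCategory.Hom a b : V)).hom ≫
      eComp V a b c) ▷ a ≫ lev a c =
      inCtx _ (lev a b) ≫ lev b c := by
  have h := tensorHom_self_comp (𝟙 (EnrichedCategory.Hom a b : V))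
    (𝟙 (EnrichedCategory.Hom b c : V))
  rw [id_tensorHom_id, Category.id_comp] at h
  rw [comp_whiskerRight, Category.assoc, whiskerRight_lev, h, MonoidalClosed.uncurry_curry]
  have h2 : MonoidalClosed.uncurry (𝟙 (EnrichedCategory.Hom b c : V)) = (β_ _ _).hom ≫ lev b c := by
    rw [lev, SymmetricCategory.symmetry_assoc]; exact MonoidalClosed.uncurry_id_eq_ev b c
  have h1 : MonoidalClosed.uncurry (𝟙 (EnrichedCategory.Hom a b : V)) = (β_ _ _).hom ≫ lev a b := by
    rw [lev, SymmetricCategory.symmetry_assoc]; exact MonoidalClosed.uncurry_id_eq_ev a b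
  rw [h1, h2, inCtx]
  simp only [comp_whiskerRight, Category.assoc, braiding_naturality_left_assoc]
  rw [reassoc_of% braiding_reverse]

end LeftEval

/-! ### V-valued functors as right modules, natural families as linear maps -/

section Action

variable {V : Type v} [Category.{w} V] [MonoidalCategory V] [MonoidalClosed V]
variable {A : Type u₁} [EnrichedCategory V A]

/-- The action `F j ⊗ A(j, k) ⟶ F k` of a `V`-functor `F : A ⟶ V`. -/
def ract (F : EnrichedFunctor V A V) (j k : A) : F.obj j ⊗ (j ⟶[V] k) ⟶ F.obj k :=
  MonoidalClosed.uncurry (F.map j k)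

theorem ract_ract (F : EnrichedFunctor V A V) (j k l : A) :
    ract F j k ▷ _ ≫ ract F k l = inCtx _ (eComp V j k l) ≫ ract F j l := by
  have h := F.map_comp j k l
  rw [tensorHom_self_comp, ← MonoidalClosed.uncurry_injective.eq_iff,
    MonoidalClosed.uncurry_curry, MonoidalClosed.uncurry_natural_left] at h
  rw [inCtx, ract, ract, ract, Category.assoc, h, Iso.hom_inv_id_assoc]

/-- A family of morphisms `X ⊗ F k ⟶ G k` that commutes with the actions of `A`. -/
def IsLinear {X : V} {F G : EnrichedFunctor V A V} (f : ∀ k, X ⊗ F.obj k ⟶ G.obj k) : Prop :=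
  ∀ j k, f j ▷ _ ≫ ract G j k = inCtx X (ract F j k) ≫ f k

end Action

section Families

variable {V : Type v} [Category.{w} V] [MonoidalCategory V] [SymmetricCategory V] [MonoidalClosed V]
variable {A : Type u₁} [EnrichedCategory V A]

/-- Both sides of the naturality square are transposed and X is moved past F j. What remains is an
associativity law without braidings, f(x) · a = f(x · a). -/
theorem isLinear_iff {X : V} {F G : EnrichedFunctor V A V}
    (f : ∀ k, X ⟶ (EnrichedCategory.Hom (F.obj k) (G.obj k) : V)) :
    IsLinear (F := F) (G := G) (fun k ↦ f k ▷ _ ≫ lev _ _) ↔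
      ∀ j k, (f j ⊗ₘ G.map j k) ≫ eComp V (F.obj j) (G.obj j) (G.obj k) =
        (β_ X (j ⟶[V] k)).hom ≫ (F.map j k ⊗ₘ f k) ≫ eComp V (F.obj j) (F.obj k) (G.obj k) := by
  refine forall₂_congr fun j k ↦ ?_
  dsimp only
  rw [tensorHom_self_comp, tensorHom_self_comp, ← MonoidalClosed.curry_natural_left,
    MonoidalClosed.curry_injective.eq_iff, whiskerRight_lev, whiskerRight_lev, inCtx, ract, ract]
  rw [← cancel_epi ((β_ X (F.obj j)).hom ▷ (j ⟶[V] k) ≫ (α_ _ _ _).hom)]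
  have h : (β_ X (F.obj j)).hom ▷ (j ⟶[V] k) ≫ (α_ _ _ _).hom ≫ _ ◁ (β_ X (j ⟶[V] k)).hom ≫
      (α_ _ _ _).inv = (α_ _ _ _).hom ≫ (β_ X (F.obj j ⊗ (j ⟶[V] k))).hom := by
    rw [braiding_tensor_right_hom, Iso.hom_inv_id_assoc]
  simp only [comp_whiskerRight, Category.assoc, Iso.hom_inv_id_assoc, reassoc_of% h,
    braiding_naturality_right_assoc]

end Families

section CompHom

variable {V : Type v} [Category.{w} V] [MonoidalCategory V]
variable {C : Type u₂} [EnrichedCategory V C] {D : Type u₃} [EnrichedCategory V D]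

/-- The action `C(d, a) ⊗ X ⟶ C(d, b)` of `f : X ⟶ C(a, b)`. -/
def compHom {X : V} (d : C) {a b : C} (f : X ⟶ (a ⟶[V] b)) : (d ⟶[V] a) ⊗ X ⟶ (d ⟶[V] b) :=
  _ ◁ f ≫ eComp V d a b

/-- Associativity of composition: an equation between composites out of a persists after composing
with C(d, a). It carries naturality of counits and the equations of split cones over to generalized
elements of C(d, -). -/
theorem whiskerRight_compHom {X Y Z : V} {a b c d : C} {f : X ⟶ (a ⟶[V] b)} {g : Y ⟶ (b ⟶[V] c)}
    {r : X ⊗ Y ⟶ Z} {h : Z ⟶ (a ⟶[V] c)} (e : f ▷ Y ≫ compHom a g = r ≫ h) :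
    compHom d f ▷ Y ≫ compHom d g = inCtx _ r ≫ compHom d h := by
  rw [compHom, compHom, compHom, comp_whiskerRight_assoc, ← whisker_exchange_assoc, eComp_eComp,
    reassoc_of% inCtx_whiskerRight, reassoc_of% inCtx_whiskerLeft, ← compHom, e,
    reassoc_of% inCtx_comp]

theorem eId_compHom {X : V} {a b : C} (f : X ⟶ (a ⟶[V] b)) :
    eId V a ▷ X ≫ compHom a f = (λ_ X).hom ≫ f := by
  rw [compHom, ← id_star, MonoidalCategory.tensorHom_def, Category.assoc]

theorem compHom_eId (d a : C) : compHom d (eId V a) = (ρ_ _).hom := by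
  rw [← cancel_epi (ρ_ _).inv, compHom, e_comp_id, Iso.inv_hom_id]

theorem compHom_map (P : EnrichedFunctor V C D) {X : V} (d : C) {a b : C} (f : X ⟶ (a ⟶[V] b)) :
    compHom d f ≫ P.map d b = P.map d a ▷ X ≫ compHom (P.obj d) (f ≫ P.map a b) := by
  rw [compHom, compHom, Category.assoc, P.map_comp, MonoidalCategory.tensorHom_def',
    Category.assoc, MonoidalCategory.whiskerLeft_comp, Category.assoc, whisker_exchange_assoc,
    whisker_exchange_assoc]

end CompHom

section RepresentableAction

variable {V : Type v} [Category.{w} V] [MonoidalCategory V] [MonoidalClosed V]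
variable {A : Type u₁} [EnrichedCategory V A] {C : Type u₂} [EnrichedCategory V C]

@[simp]
theorem ract_coyo (a j k : A) : ract (coyo V a) j k = eComp V a j k :=
  MonoidalClosed.uncurry_curry _

@[simp]
theorem ract_coyoComp (d : C) (T : EnrichedFunctor V A C) (j k : A) :
    ract (coyoComp d T) j k = compHom d (T.map j k) := by
  rw [ract, compHom, MonoidalClosed.uncurry_natural_left, MonoidalClosed.uncurry_curry]

end RepresentableAction

section LeftComp

variable {V : Type v} [Category.{w} V] [MonoidalCategory V] [SymmetricCategory V]
variable {C : Type u₁} [EnrichedCategory V C]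

variable (V) in
/-- Composition `C(b, c) ⊗ C(a, b) ⟶ C(a, c)`. -/
def lcomp (a b c : C) : (b ⟶[V] c) ⊗ (a ⟶[V] b) ⟶ (a ⟶[V] c) :=
  (β_ _ _).hom ≫ eComp V a b c

end LeftComp

/-! ### The dual of a weight and nuclearity -/

section FunctorEval

variable {V : Type v} [Category.{w} V] [MonoidalCategory V] [SymmetricCategory V] [MonoidalClosed V]
  [HasLimits V]
variable {A : Type u₁} [EnrichedCategory V A] [IsSmall V A]

/-- Evaluation `[A, V](F, G) ⊗ F k ⟶ G k`. -/
def fev (F G : EnrichedFunctor V A V) (k : A) : (F ⟶[V] G) ⊗ F.obj k ⟶ G.obj k :=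
  (natHomπ F G).app k ▷ _ ≫ lev _ _

theorem fev_isLinear (F G : EnrichedFunctor V A V) : IsLinear (fev F G) :=
  (isLinear_iff (natHomπ F G).app).2 (natHomπ F G).naturality

theorem fev_ext {X : V} {F G : EnrichedFunctor V A V} {f g : X ⟶ (F ⟶[V] G)}
    (h : ∀ k, f ▷ _ ≫ fev F G k = g ▷ _ ≫ fev F G k) : f = g :=
  natHom_ext fun k ↦ lev_ext (by
    simpa only [fev, ← comp_whiskerRight_assoc] using h k)

/-- The morphism `X ⟶ [A, V](F, G)` given by a linear family. -/
def IsLinear.lift {X : V} {F G : EnrichedFunctor V A V} {f : ∀ k, X ⊗ F.obj k ⟶ G.obj k}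
    (hf : IsLinear f) : X ⟶ (F ⟶[V] G) :=
  NatFamily.lift ⟨fun k ↦ lcurry (f k), (isLinear_iff _).1 (by simpa only [lcurry_lev] using hf)⟩

@[simp]
theorem IsLinear.lift_fev {X : V} {F G : EnrichedFunctor V A V} {f : ∀ k, X ⊗ F.obj k ⟶ G.obj k}
    (hf : IsLinear f) (k : A) : hf.lift ▷ _ ≫ fev F G k = f k := by
  rw [fev, ← comp_whiskerRight_assoc, lift, NatFamily.lift_π, lcurry_lev]

theorem eId_fev (F : EnrichedFunctor V A V) (k : A) :
    eId V F ▷ _ ≫ fev F F k = (λ_ _).hom := by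
  have h : eId V F ≫ (natHomπ F F).app k = eId V (F.obj k) := NatFamily.lift_π _ k
  rw [fev, ← comp_whiskerRight_assoc, h, whiskerRight_lev]
  have h' : MonoidalClosed.uncurry (eId V (F.obj k)) = (ρ_ _).hom := by
    rw [MonoidalClosed.enrichedCategorySelf_id, MonoidalClosed.id, MonoidalClosed.uncurry_curry]
  rw [h', braiding_rightUnitor]

theorem lcomp_fev (F G H : EnrichedFunctor V A V) (k : A) :
    lcomp V F G H ▷ _ ≫ fev F H k = inCtx _ (fev F G k) ≫ fev G H k := by
  have h : eComp V F G H ≫ (natHomπ F H).app k =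
      ((natHomπ F G).app k ⊗ₘ (natHomπ G H).app k) ≫ eComp V _ _ _ := NatFamily.lift_π _ k
  rw [fev, ← comp_whiskerRight_assoc, lcomp, Category.assoc, h, ← braiding_naturality_assoc,
    comp_whiskerRight_assoc, eComp_lev, fev, fev, ← inCtx_whiskerLeft, Category.assoc,
    ← reassoc_of% inCtx_naturality, MonoidalCategory.tensorHom_def', comp_whiskerRight_assoc]

variable (φ : EnrichedFunctor V A V)

/-- On elements the family is x ⊗ f ⊗ p ↦ x · f(p), linear in p because f is linear and the action
on F is associative. -/
theorem yonedaComp_isLinear (F : EnrichedFunctor V A V) (b : A) :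
    IsLinear (fun c ↦ inCtx (F.obj b) (fev φ (coyo V b) c) ≫ ract F b c) := by
  intro j k
  dsimp only
  have h := inCtx_assoc (F.obj b) (fev_isLinear φ (coyo V b) j k)
  rw [ract_coyo] at h
  rw [comp_whiskerRight_assoc, ract_ract, reassoc_of% h]

/-- The composition `F b ⊗ [A, V](φ, A(b, -)) ⟶ [A, V](φ, F)`, where `F b ≅ [A, V](A(b, -), F)`. -/
def yonedaComp (F : EnrichedFunctor V A V) (b : A) :
    F.obj b ⊗ (φ ⟶[V] coyo V b) ⟶ (φ ⟶[V] F) :=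
  (yonedaComp_isLinear φ F b).lift

theorem yonedaComp_fev (F : EnrichedFunctor V A V) (b c : A) :
    yonedaComp φ F b ▷ _ ≫ fev φ F c = inCtx _ (fev φ (coyo V b) c) ≫ ract F b c :=
  (yonedaComp_isLinear φ F b).lift_fev c

/-- The law (x · a) · f = x · (a · f). For representable F it makes φ♯ a left module; for general F
it says that the compositions are balanced over A. -/
theorem ract_yonedaComp (F : EnrichedFunctor V A V) (j k : A) :
    ract F j k ▷ _ ≫ yonedaComp φ F k =
      inCtx _ (yonedaComp φ (coyo V j) k) ≫ yonedaComp φ F j := by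
  refine fev_ext fun c ↦ ?_
  have h := inCtx_assoc (F.obj j) (yonedaComp_fev φ (coyo V j) k c)
  rw [ract_coyo] at h
  rw [comp_whiskerRight_assoc, comp_whiskerRight_assoc, yonedaComp_fev, yonedaComp_fev,
    reassoc_of% inCtx_naturality, ract_ract, reassoc_of% h]

/-- The law u(x) · f = u ∘ (x · f), i.e. naturality of the compositions in F. -/
theorem fev_yonedaComp (F G : EnrichedFunctor V A V) (b : A) :
    fev F G b ▷ _ ≫ yonedaComp φ G b = inCtx _ (yonedaComp φ F b) ≫ lcomp V φ F G := by
  refine fev_ext fun c ↦ ?_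
  have h := inCtx_assoc (F ⟶[V] G) (yonedaComp_fev φ F b c)
  rw [comp_whiskerRight_assoc, comp_whiskerRight_assoc, yonedaComp_fev, lcomp_fev,
    reassoc_of% inCtx_naturality, fev_isLinear, reassoc_of% h]

/-- The compositions `φ b ⊗ [A, V](φ, A(b, -)) ⟶ [A, V](φ, φ)` exhibit `[A, V](φ, φ)` as the coend
of their domains, and this coend is preserved by all `X ⊗ -`. -/
def IsNuclear : Prop :=
  ∀ (X Y : V) (θ : ∀ b, (X ⊗ φ.obj b) ⊗ (φ ⟶[V] coyo V b) ⟶ Y),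
    (∀ j k, inCtx X (ract φ j k) ▷ _ ≫ θ k = inCtx _ (yonedaComp φ (coyo V j) k) ≫ θ j) →
    ∃! t : X ⊗ (φ ⟶[V] φ) ⟶ Y, ∀ b, inCtx X (yonedaComp φ φ b) ≫ t = θ b

end FunctorEval

/-! ### The universal property of weighted limits on generalized elements -/

section Cones

variable {V : Type v} [Category.{w} V] [MonoidalCategory V] [SymmetricCategory V] [MonoidalClosed V]
variable {A : Type u₁} [EnrichedCategory V A] {C : Type u₂} [EnrichedCategory V C]

variable {φ : EnrichedFunctor V A V} {T : EnrichedFunctor V A C}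

/-- Morphisms X ⟶ [A, V](φ, C(d, T -)) are linear families. Conversely, the family given by
evaluation produces the inverse of the comparison. -/
theorem WeightedCone.isLimit_iff [HasLimits V] [IsSmall V A] (c : WeightedCone φ T) :
    c.IsLimit ↔ ∀ (d : C) (X : V) (m : ∀ k, X ⊗ φ.obj k ⟶ (d ⟶[V] T.obj k)),
      IsLinear (F := φ) (G := coyoComp d T) m →
        ∃! x : X ⟶ (d ⟶[V] c.pt), ∀ k, x ▷ _ ≫ compHom d (c.counit k) = m k := by
  have key (d : C) (k : A) : c.comparison d ▷ _ ≫ fev φ (coyoComp d T) k =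
      compHom d (c.counit k) := by
    rw [fev, ← comp_whiskerRight_assoc, comparison, NatFamily.lift_π, family]
    exact lcurry_lev _
  constructor
  · intro h d X m hm
    have := h d
    refine ⟨hm.lift ≫ inv (c.comparison d), fun k ↦ ?_, fun y hy ↦ ?_⟩
    · rw [← key, comp_whiskerRight_assoc, ← comp_whiskerRight_assoc (inv _), IsIso.inv_hom_id,
        id_whiskerRight, Category.id_comp, hm.lift_fev]
    · rw [IsIso.eq_comp_inv]
      refine fev_ext fun k ↦ ?_
      rw [comp_whiskerRight_assoc, key, hy, hm.lift_fev]
  · intro h d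
    obtain ⟨x, hx, -⟩ := h d _ _ (fev_isLinear φ (coyoComp d T))
    have h1 : x ≫ c.comparison d = 𝟙 _ := fev_ext fun k ↦ by
      rw [comp_whiskerRight_assoc, key, hx]; simp
    have hl : IsLinear (F := φ) (G := coyoComp d T) fun k ↦ compHom d (c.counit k) := by
      intro j k
      dsimp only
      rw [← key, comp_whiskerRight_assoc, fev_isLinear, ← key, reassoc_of% inCtx_naturality]
    refine ⟨x, (h d _ _ hl).unique (fun k ↦ ?_) (fun k ↦ ?_), h1⟩
    · rw [← key, ← comp_whiskerRight_assoc, Category.assoc, h1, Category.comp_id]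
    · simp

end Cones

/-! ### Split cones; nuclear weights are absolute -/

section Absolute

variable {V : Type v} [Category.{w} V] [MonoidalCategory V] [SymmetricCategory V] [MonoidalClosed V]
variable {A : Type u₁} [EnrichedCategory V A] {C : Type u₂} [EnrichedCategory V C]
  {D : Type u₃} [EnrichedCategory V D]
variable {φ : EnrichedFunctor V A V} {T : EnrichedFunctor V A C}

omit [SymmetricCategory V] in
theorem WeightedCone.counit_compHom (c : WeightedCone φ T) (j k : A) :
    c.counit j ▷ _ ≫ compHom c.pt (T.map j k) = ract φ j k ≫ c.counit k := by
  rw [ract, c.naturality, compHom, MonoidalCategory.tensorHom_def, Category.assoc]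

variable [HasLimits V] [IsSmall V A]

/-- A cone that is a limit because of equations, which are preserved by all `V`-functors: `δ` is a
cocone on `T` weighted by `[A, V](φ, A(b, -))`, and the counit and `δ` are related in the same way
as the unit and the counit of a dual pair. -/
def WeightedCone.IsSplit (c : WeightedCone φ T) : Prop :=
  ∃ (δ : ∀ b, (φ ⟶[V] coyo V b) ⟶ (T.obj b ⟶[V] c.pt)) (s : (φ ⟶[V] φ) ⟶ (c.pt ⟶[V] c.pt)),
    (∀ j k, T.map j k ▷ _ ≫ compHom (T.obj j) (δ k) = yonedaComp φ (coyo V j) k ≫ δ j) ∧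
    (∀ b k, δ b ▷ _ ≫ compHom (T.obj b) (c.counit k) = fev φ (coyo V b) k ≫ T.map b k) ∧
    (∀ b, c.counit b ▷ _ ≫ compHom c.pt (δ b) = yonedaComp φ φ b ≫ s) ∧
    eId V φ ≫ s = eId V c.pt

/-- The objects φ♯ b and [A, V](φ, φ) do not involve C, so functoriality of P is all that is needed.
-/
theorem WeightedCone.IsSplit.map {c : WeightedCone φ T} (h : c.IsSplit)
    (P : EnrichedFunctor V C D) :
    (c.map P).IsSplit := by
  obtain ⟨δ, s, h₁, h₂, h₃, h₄⟩ := h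
  refine ⟨fun b ↦ δ b ≫ P.map _ _, s ≫ P.map _ _, fun j k ↦ ?_, fun b k ↦ ?_, fun b ↦ ?_, ?_⟩
  · have := h₁ j k =≫ P.map _ _
    rw [Category.assoc, compHom_map, ← comp_whiskerRight_assoc, Category.assoc] at this
    exact this
  · have := h₂ b k =≫ P.map _ _
    rw [Category.assoc, compHom_map, ← comp_whiskerRight_assoc, Category.assoc] at this
    exact this
  · have := h₃ b =≫ P.map _ _
    rw [Category.assoc, compHom_map, ← comp_whiskerRight_assoc, Category.assoc] at this
    exact this
  · exact (Category.assoc _ _ _).symm.trans ((congrArg (· ≫ _) h₄).trans (P.map_id _))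

theorem WeightedCone.IsLimit.hom_ext {c : WeightedCone φ T} (h : c.IsLimit) {d : C} {X : V}
    {x y : X ⟶ (d ⟶[V] c.pt)}
    (hxy : ∀ k, x ▷ _ ≫ compHom d (c.counit k) = y ▷ _ ≫ compHom d (c.counit k)) : x = y := by
  refine (c.isLimit_iff.1 h d X (fun k ↦ y ▷ _ ≫ compHom d (c.counit k)) fun j k ↦ ?_).unique hxy
    fun _ ↦ rfl
  rw [ract_coyoComp, comp_whiskerRight_assoc, whiskerRight_compHom (c.counit_compHom j k),
    reassoc_of% inCtx_naturality]

/-- No nuclearity is needed. Into the limit, δ b is induced by f ⊗ p ↦ T(f(p)), and s by the action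
of endomorphisms of φ on the weight. All equations except the defining one for δ are checked after
composing with the counits. -/
theorem WeightedCone.IsLimit.isSplit {c : WeightedCone φ T} (h : c.IsLimit) : c.IsSplit := by
  have hδ (b : A) := (c.isLimit_iff.1 h (T.obj b) _
    (fun k ↦ fev φ (coyo V b) k ≫ T.map b k) fun j k ↦ by
      have h1 := fev_isLinear φ (coyo V b) j k
      have h2 : T.map b j ▷ _ ≫ compHom (T.obj b) (T.map j k) = eComp V b j k ≫ T.map b k := by
        rw [T.map_comp, compHom, MonoidalCategory.tensorHom_def, Category.assoc]
      rw [ract_coyo] at h1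
      rw [ract_coyoComp, comp_whiskerRight_assoc, h2, reassoc_of% h1]).exists
  choose δ hδ using hδ
  obtain ⟨s, hs⟩ := (c.isLimit_iff.1 h c.pt _ (fun k ↦ fev φ φ k ≫ c.counit k) fun j k ↦ by
      rw [ract_coyoComp, comp_whiskerRight_assoc, c.counit_compHom, ← Category.assoc,
        fev_isLinear, Category.assoc]).exists
  refine ⟨δ, s, fun j k ↦ h.hom_ext fun l ↦ ?_, hδ, fun b ↦ h.hom_ext fun l ↦ ?_,
    h.hom_ext fun l ↦ ?_⟩
  · have h2 : T.map j k ▷ _ ≫ compHom (T.obj j) (T.map k l) = eComp V j k l ≫ T.map j l := by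
      rw [T.map_comp, compHom, MonoidalCategory.tensorHom_def, Category.assoc]
    rw [comp_whiskerRight_assoc, comp_whiskerRight_assoc, whiskerRight_compHom (hδ k l), hδ,
      reassoc_of% inCtx_naturality, h2, reassoc_of% yonedaComp_fev, ract_coyo]
  · rw [comp_whiskerRight_assoc, comp_whiskerRight_assoc, whiskerRight_compHom (hδ b l), hs,
      reassoc_of% inCtx_naturality, c.counit_compHom, reassoc_of% yonedaComp_fev]
  · rw [comp_whiskerRight_assoc, hs, reassoc_of% eId_fev, eId_compHom]

/-- By closedness Z can be moved into the target, so the compositions stay jointly epimorphic after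
tensoring on the right. -/
theorem IsNuclear.hom_ext (h : IsNuclear φ) {X Y Z : V} {f g : (X ⊗ (φ ⟶[V] φ)) ⊗ Z ⟶ Y}
    (hfg : ∀ b, inCtx X (yonedaComp φ φ b) ▷ _ ≫ f = inCtx X (yonedaComp φ φ b) ▷ _ ≫ g) :
    f = g := by
  suffices hl : lcurry f = lcurry g by rw [← lcurry_lev f, hl, lcurry_lev]
  refine (h X _ (fun b ↦ inCtx X (yonedaComp φ φ b) ≫ lcurry g) fun j k ↦ ?_).unique
    (fun b ↦ lev_ext ?_) fun _ ↦ rfl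
  · rw [← Category.assoc, inCtx_assoc X (ract_yonedaComp φ φ j k), Category.assoc]
  · rw [comp_whiskerRight_assoc, comp_whiskerRight_assoc, lcurry_lev, lcurry_lev, hfg]

/-- Where the identity of φ is a sum of products x · f, the mediating map would be the sum of the
δ(f) ∘ m(x). The coend makes this meaningful: these composites define t on X ⊗ [A, V](φ, φ), and t
is evaluated at the identity. -/
theorem IsNuclear.isLimit (h : IsNuclear φ) {c : WeightedCone φ T} (hc : c.IsSplit) :
    c.IsLimit := by
  obtain ⟨δ, s, h₁, h₂, h₃, h₄⟩ := hc
  refine c.isLimit_iff.2 fun d X m hm ↦ ?_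
  have hθ (j k : A) : inCtx X (ract φ j k) ▷ _ ≫ m k ▷ _ ≫ compHom d (δ k) =
      inCtx _ (yonedaComp φ (coyo V j) k) ≫ m j ▷ _ ≫ compHom d (δ j) := by
    have := hm j k
    rw [ract_coyoComp] at this
    rw [← comp_whiskerRight_assoc, ← this, comp_whiskerRight_assoc, whiskerRight_compHom (h₁ j k),
      reassoc_of% inCtx_naturality]
  obtain ⟨t, ht, htu⟩ := h X _ (fun b ↦ m b ▷ _ ≫ compHom d (δ b)) hθ
  refine ⟨(ρ_ X).inv ≫ X ◁ eId V φ ≫ t, fun l ↦ ?_, fun x hx ↦ ?_⟩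
  -- Existence: on a product x · f, both sides give m applied to x · f(p), by the second splitting
  -- equation and linearity of m.
  · have key : t ▷ _ ≫ compHom d (c.counit l) = inCtx X (fev φ φ l) ≫ m l := by
      refine h.hom_ext fun b ↦ ?_
      have := hm b l
      rw [ract_coyoComp] at this
      rw [← comp_whiskerRight_assoc, ht, comp_whiskerRight_assoc, whiskerRight_compHom (h₂ b l),
        reassoc_of% inCtx_naturality, this, reassoc_of% (inCtx_assoc X (yonedaComp_fev φ φ b l))]
    rw [comp_whiskerRight_assoc, comp_whiskerRight_assoc, key, reassoc_of% inCtx_whiskerLeft,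
      eId_fev,
      reassoc_of% inCtx_unit]
    simp
  -- Uniqueness: for a factorization x of m, the map x followed by the action of s satisfies the
  -- equations defining t. At the identity of φ it returns x, since s sends identity to identity.
  · rw [← htu (x ▷ _ ≫ compHom d s) fun b ↦ ?_]
    · rw [whisker_exchange_assoc, ← rightUnitor_inv_naturality_assoc]
      have : (d ⟶[V] c.pt) ◁ eId V φ ≫ compHom d s = (ρ_ _).hom := by
        rw [← compHom_eId, ← h₄, compHom, compHom, MonoidalCategory.whiskerLeft_comp,
          Category.assoc]
      rw [this, Iso.inv_hom_id, Category.comp_id]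
    · rw [← reassoc_of% inCtx_naturality, ← whiskerRight_compHom (h₃ b),
        ← comp_whiskerRight_assoc, hx]

end Absolute

section

variable {V : Type v} [Category.{w} V] [MonoidalCategory V] [SymmetricCategory V] [MonoidalClosed V]
  [HasLimits V] {B : Type u} [EnrichedCategory V B] [IsSmall V B]

theorem IsNuclear.isAbsoluteForLimits {φ : EnrichedFunctor V Bᵒᵖ V} (h : IsNuclear φ) :
    IsAbsoluteForLimits.{w, v, u, t} φ :=
  fun _ _ _ _ _ P _ hc ↦ h.isLimit (hc.isSplit.map P)

theorem IsAbsoluteForLimits.isAbsoluteForColimits {φ : EnrichedFunctor V Bᵒᵖ V}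
    (h : IsAbsoluteForLimits.{w, v, u, t} φ) : IsAbsoluteForColimits.{w, v, u, t} φ :=
  fun C D _ _ S P ↦ h Cᵒᵖ Dᵒᵖ (opFunctor S) (opFunctor P)

end

/-! ### Universal properties of colimits in V and in functor categories -/

section Colimits

variable {V : Type v} [Category.{w} V] [MonoidalCategory V] [SymmetricCategory V]

/-- The action `E(b, d) ⊗ X ⟶ E(a, d)` of `f : X ⟶ E(a, b)`. -/
def precompHom {E : Type u₂} [EnrichedCategory V E] {X : V} {a b : E} (d : E)
    (f : X ⟶ (a ⟶[V] b)) : (b ⟶[V] d) ⊗ X ⟶ (a ⟶[V] d) :=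
  _ ◁ f ≫ lcomp V a b d

theorem precompHom_lev [MonoidalClosed V] {X a b : V} (d : V)
    (f : X ⟶ EnrichedCategory.Hom a b) :
    precompHom d f ▷ a ≫ lev a d = inCtx _ (f ▷ a ≫ lev a b) ≫ lev b d := by
  rw [precompHom, lcomp, comp_whiskerRight_assoc, eComp_lev, reassoc_of% inCtx_whiskerLeft]

variable {K : Type u₁} [EnrichedCategory V K]
/-- The component `ψ k ⟶ E(S k, pt)` of the unit of a cone on the opposite of `S`. -/
def WeightedCone.cocounit [MonoidalClosed V] {E : Type u₂} [EnrichedCategory V E]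
    {ψ : EnrichedFunctor V Kᵒᵖ V} {S : EnrichedFunctor V K E} (c : WeightedCone ψ (opFunctor S))
    (k : Kᵒᵖ) : ψ.obj k ⟶ (S.obj k.unop ⟶[V] c.pt.unop) :=
  c.counit k

variable [MonoidalClosed V] [HasLimits V] [IsSmall V K]

theorem WeightedCone.isLimit_opFunctor_iff {E : Type u₂} [EnrichedCategory V E]
    {ψ : EnrichedFunctor V Kᵒᵖ V} {S : EnrichedFunctor V K E} (c : WeightedCone ψ (opFunctor S)) :
    c.IsLimit ↔ ∀ (d : E) (X : V) (m : ∀ k : Kᵒᵖ, X ⊗ ψ.obj k ⟶ (S.obj k.unop ⟶[V] d)),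
      (∀ j k, m j ▷ _ ≫ precompHom d (S.map k.unop j.unop) = inCtx X (ract ψ j k) ≫ m k) →
        ∃! x : X ⟶ (c.pt.unop ⟶[V] d), ∀ k, x ▷ _ ≫ precompHom d (c.cocounit k) = m k := by
  have h (d : E) (X : V) (m : ∀ k : Kᵒᵖ, X ⊗ ψ.obj k ⟶ (S.obj k.unop ⟶[V] d)) :
      IsLinear (F := ψ) (G := coyoComp (.op d) (opFunctor S)) m ↔
        ∀ j k, m j ▷ _ ≫ precompHom d (S.map k.unop j.unop) = inCtx X (ract ψ j k) ≫ m k := by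
    refine forall₂_congr fun j k ↦ ?_
    rw [ract_coyoComp]
    rfl
  exact c.isLimit_iff.trans ⟨fun H d X m hm ↦ H (.op d) X m ((h d X m).2 hm),
    fun H d X m hm ↦ H d.unop X m ((h d.unop X m).1 hm)⟩

/-- Transposing maps X ⟶ [pt, Y] puts the universal property in the form used by `IsNuclear`; the
parameter X encodes its enrichment. -/
theorem WeightedCone.isColimit_self_iff {ψ : EnrichedFunctor V Kᵒᵖ V} {S : EnrichedFunctor V K V}
    (c : WeightedCone ψ (opFunctor S)) :
    c.IsLimit ↔ ∀ (Y X : V) (θ : ∀ k : Kᵒᵖ, (X ⊗ ψ.obj k) ⊗ S.obj k.unop ⟶ Y),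
      (∀ j k : Kᵒᵖ, inCtx X (ract ψ j k) ▷ _ ≫ θ k =
        inCtx _ (S.map k.unop j.unop ▷ _ ≫ lev _ _) ≫ θ j) →
        ∃! t : X ⊗ c.pt.unop ⟶ Y, ∀ k : Kᵒᵖ,
          inCtx X (c.cocounit k ▷ _ ≫ lev _ _) ≫ t = θ k := by
  rw [c.isLimit_opFunctor_iff]
  have h1 {X Y : V} (x : X ⟶ EnrichedCategory.Hom c.pt.unop Y) (k : Kᵒᵖ) :
      (x ▷ _ ≫ precompHom Y (c.cocounit k)) ▷ _ ≫ lev (S.obj k.unop) Y =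
        inCtx X (c.cocounit k ▷ _ ≫ lev _ _) ≫ x ▷ _ ≫ lev _ _ := by
    rw [comp_whiskerRight_assoc, ← reassoc_of% inCtx_naturality]
    rw [precompHom_lev]
  constructor
  · intro H Y X θ hθ
    obtain ⟨x, hx, hu⟩ := H Y X (fun k ↦ lcurry (θ k)) fun j k ↦ lev_ext (by
      rw [comp_whiskerRight_assoc, precompHom_lev, reassoc_of% inCtx_naturality, lcurry_lev,
        comp_whiskerRight_assoc, lcurry_lev, hθ])
    refine ⟨x ▷ _ ≫ lev _ _, fun k ↦ ?_, fun t ht ↦ ?_⟩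
    · rw [← h1, hx, lcurry_lev]
    · rw [← hu (lcurry t) fun k ↦ lev_ext ?_, lcurry_lev]
      rw [h1, lcurry_lev, lcurry_lev, ht]
  · intro H Y X m hm
    obtain ⟨t, ht, hu⟩ := H Y X (fun k ↦ m k ▷ _ ≫ lev _ _) fun j k ↦ by
      rw [← comp_whiskerRight_assoc, ← hm, comp_whiskerRight_assoc, precompHom_lev,
        reassoc_of% inCtx_naturality]
    refine ⟨lcurry t, fun k ↦ lev_ext ?_, fun x hx ↦ lev_ext ?_⟩
    · rw [h1, lcurry_lev, ht]
    · rw [lcurry_lev]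
      exact hu _ fun k ↦ by rw [← h1, hx]

variable {A : Type u₂} [EnrichedCategory V A] [IsSmall V A]

theorem precompHom_fev {X : V} {F G : EnrichedFunctor V A V} (H : EnrichedFunctor V A V)
    (f : X ⟶ (F ⟶[V] G)) (a : A) :
    precompHom H f ▷ _ ≫ fev F H a = inCtx _ (f ▷ _ ≫ fev F G a) ≫ fev G H a := by
  rw [precompHom, comp_whiskerRight_assoc, lcomp_fev, reassoc_of% inCtx_whiskerLeft]

theorem WeightedCone.isColimit_functor_iff {ψ : EnrichedFunctor V Kᵒᵖ V}
    {S : EnrichedFunctor V K (EnrichedFunctor V A V)} (c : WeightedCone ψ (opFunctor S)) :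
    c.IsLimit ↔ ∀ (G : EnrichedFunctor V A V) (X : V)
      (m : ∀ (k : Kᵒᵖ) (a : A), (X ⊗ ψ.obj k) ⊗ (S.obj k.unop).obj a ⟶ G.obj a),
      (∀ k, IsLinear (m k)) →
      (∀ (j k : Kᵒᵖ) (a : A), inCtx X (ract ψ j k) ▷ _ ≫ m k a =
        inCtx _ (S.map k.unop j.unop ▷ _ ≫ fev _ _ a) ≫ m j a) →
        ∃! x : X ⟶ (c.pt.unop ⟶[V] G), ∀ (k : Kᵒᵖ) (a : A),
          inCtx X (c.cocounit k ▷ _ ≫ fev _ _ a) ≫ x ▷ _ ≫ fev _ _ a = m k a := by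
  rw [c.isLimit_opFunctor_iff]
  have h1 {X : V} {G : EnrichedFunctor V A V} (x : X ⟶ (c.pt.unop ⟶[V] G)) (k : Kᵒᵖ) (a : A) :
      (x ▷ _ ≫ precompHom G (c.cocounit k)) ▷ _ ≫ fev (S.obj k.unop) G a =
        inCtx X (c.cocounit k ▷ _ ≫ fev _ _ a) ≫ x ▷ _ ≫ fev _ _ a := by
    rw [comp_whiskerRight_assoc, ← reassoc_of% inCtx_naturality]
    rw [precompHom_fev]
  constructor
  · intro H G X m hl hm
    obtain ⟨x, hx, hu⟩ := H G X (fun k ↦ (hl k).lift) fun j k ↦ fev_ext fun a ↦ by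
      rw [comp_whiskerRight_assoc, precompHom_fev, reassoc_of% inCtx_naturality, (hl j).lift_fev,
        comp_whiskerRight_assoc, (hl k).lift_fev, hm]
    refine ⟨x, fun k a ↦ ?_, fun y hy ↦ hu y fun k ↦ fev_ext fun a ↦ ?_⟩
    · rw [← h1, hx, (hl k).lift_fev]
    · rw [h1, hy, (hl k).lift_fev]
  · intro H G X m hm
    obtain ⟨x, hx, hu⟩ := H G X (fun k a ↦ m k ▷ _ ≫ fev _ _ a)
      (fun k i j ↦ by
        dsimp only
        rw [comp_whiskerRight_assoc, fev_isLinear, reassoc_of% inCtx_naturality])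
      fun j k a ↦ by
        rw [← comp_whiskerRight_assoc, ← hm, comp_whiskerRight_assoc, precompHom_fev,
          reassoc_of% inCtx_naturality]
    refine ⟨x, fun k ↦ fev_ext fun a ↦ ?_, fun y hy ↦ hu y fun k a ↦ ?_⟩
    · rw [h1, hx]
    · rw [← h1, hy]

theorem coyo_map_lev (φ F G : EnrichedFunctor V A V) :
    (coyo V φ).map F G ▷ (φ ⟶[V] F) ≫ lev (φ ⟶[V] F) (φ ⟶[V] G) = lcomp V φ F G := by
  rw [whiskerRight_lev]
  exact congrArg (_ ≫ ·) (ract_coyo _ _ _)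

end Colimits

/-! ### The right adjoint Y ↦ [φ♯ -, Y] -/

section RightAdjoint

variable {V : Type v} [Category.{w} V] [MonoidalCategory V]

theorem whiskerLeft_eId_lcomp [SymmetricCategory V] {C : Type u₁} [EnrichedCategory V C] (a b : C) :
    (a ⟶[V] b) ◁ eId V a ≫ lcomp V a a b = (ρ_ _).hom := by
  rw [lcomp, braiding_naturality_right_assoc, ← cancel_epi ((β_ _ _).hom),
    SymmetricCategory.symmetry_assoc, braiding_rightUnitor, ← cancel_epi (λ_ _).inv, e_id_comp,
    Iso.inv_hom_id]

variable [MonoidalClosed V] {A : Type u₁} [EnrichedCategory V A]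

/-- The `V`-functor `A ⟶ V` given by objects with actions of the hom-objects of `A`. -/
abbrev functorOfAction (R : A → V) (r : ∀ j k, R j ⊗ (j ⟶[V] k) ⟶ R k)
    (h₁ : ∀ j, R j ◁ eId V j ≫ r j j = (ρ_ _).hom)
    (h₂ : ∀ j k l, r j k ▷ _ ≫ r k l = inCtx _ (eComp V j k l) ≫ r j l) :
    EnrichedFunctor V A V where
  obj := R
  map j k := MonoidalClosed.curry (r j k)
  map_id j := by
    rw [← MonoidalClosed.curry_natural_left, h₁]
    rfl
  map_comp j k l := by
    refine Eq.trans ?_ (tensorHom_self_comp _ _).symm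
    rw [← MonoidalClosed.curry_natural_left, MonoidalClosed.uncurry_curry,
      MonoidalClosed.uncurry_curry, h₂, inCtx, Category.assoc, Iso.inv_hom_id_assoc]

variable [SymmetricCategory V] [HasLimits V] [IsSmall V A] (φ : EnrichedFunctor V A V)

theorem eId_yonedaComp (j : A) : eId V j ▷ _ ≫ yonedaComp φ (coyo V j) j = (λ_ _).hom := by
  refine fev_ext fun c ↦ ?_
  have h := whisker_exchange (eId V j) (fev φ (coyo V j) c)
  have h' : eId V j ▷ _ ≫ eComp V j j c = (λ_ _).hom := by
    rw [← cancel_epi (λ_ _).inv, e_id_comp, Iso.inv_hom_id]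
  rw [comp_whiskerRight_assoc, yonedaComp_fev, reassoc_of% inCtx_naturality, ract_coyo, h', inCtx]
  simp

/-- The right action of `A` on the objects `[φ♯ a, Y]` for `φ♯ a = [A, V](φ, A(a, -))`. -/
def dualAction (Y : V) (j k : A) :
    EnrichedCategory.Hom (φ ⟶[V] coyo V j) Y ⊗ (j ⟶[V] k) ⟶
      EnrichedCategory.Hom (φ ⟶[V] coyo V k) Y :=
  lcurry (inCtx _ (yonedaComp φ (coyo V j) k) ≫ lev _ _)

theorem dualAction_lev (Y : V) (j k : A) : dualAction φ Y j k ▷ _ ≫ lev (φ ⟶[V] coyo V k) Y =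
    inCtx _ (yonedaComp φ (coyo V j) k) ≫ lev (φ ⟶[V] coyo V j) Y :=
  lcurry_lev _

/-- The right adjoint of `[A, V](φ, -)` for nuclear `φ`, with `Y ↦ (a ↦ [φ♯ a, Y])` for
`φ♯ a = [A, V](φ, A(a, -))`. -/
abbrev dualFunctor (Y : V) : EnrichedFunctor V A V :=
  functorOfAction (fun a ↦ EnrichedCategory.Hom (φ ⟶[V] coyo V a) Y) (dualAction φ Y)
    (fun j ↦ lev_ext (by
      rw [comp_whiskerRight_assoc, dualAction_lev, reassoc_of% inCtx_whiskerLeft, eId_yonedaComp,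
        inCtx]
      simp))
    (fun j k l ↦ lev_ext (by
      have h := ract_yonedaComp φ (coyo V j) k l
      rw [ract_coyo] at h
      rw [comp_whiskerRight_assoc, comp_whiskerRight_assoc, dualAction_lev, dualAction_lev,
        reassoc_of% inCtx_naturality, dualAction_lev, reassoc_of% (inCtx_assoc _ h)]))

theorem ract_dualFunctor (Y : V) (j k : A) : ract (dualFunctor φ Y) j k = dualAction φ Y j k :=
  MonoidalClosed.uncurry_curry _

/-- One half of the adjunction: families balanced over A become linear maps into the dual functor.
`isLinear_lev` is the converse. -/
theorem isLinear_lcurry {X Y : V} {F : EnrichedFunctor V A V}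
    (p : ∀ a, (X ⊗ F.obj a) ⊗ (φ ⟶[V] coyo V a) ⟶ Y)
    (hp : ∀ j k, inCtx X (ract F j k) ▷ _ ≫ p k = inCtx _ (yonedaComp φ (coyo V j) k) ≫ p j) :
    IsLinear (F := F) (G := dualFunctor φ Y) fun a ↦ lcurry (p a) := by
  intro j k
  refine lev_ext ?_
  dsimp only
  rw [ract_dualFunctor, comp_whiskerRight_assoc, comp_whiskerRight_assoc, dualAction_lev,
    reassoc_of% inCtx_naturality, lcurry_lev, lcurry_lev, hp]

theorem isLinear_lev {X Y : V} {F : EnrichedFunctor V A V}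
    {m : ∀ a, X ⊗ F.obj a ⟶ EnrichedCategory.Hom (φ ⟶[V] coyo V a) Y}
    (hm : IsLinear (F := F) (G := dualFunctor φ Y) m) (j k : A) :
    inCtx X (ract F j k) ▷ _ ≫ m k ▷ _ ≫ lev _ _ =
      inCtx _ (yonedaComp φ (coyo V j) k) ≫ m j ▷ _ ≫ lev _ _ := by
  have h := hm j k
  rw [ract_dualFunctor] at h
  rw [← comp_whiskerRight_assoc, ← h, comp_whiskerRight_assoc, dualAction_lev,
    reassoc_of% inCtx_naturality]

end RightAdjoint

/-! ### Nuclear weights are small projective -/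

section SmallProjective

variable {V : Type v} [Category.{w} V] [MonoidalCategory V] [SymmetricCategory V] [MonoidalClosed V]
  [HasLimits V]
variable {K : Type u₁} [EnrichedCategory V K] [IsSmall V K]
variable {A : Type u₂} [EnrichedCategory V A] [IsSmall V A] {φ : EnrichedFunctor V A V}

theorem WeightedCone.isColimit_map_coyo_iff {ψ : EnrichedFunctor V Kᵒᵖ V}
    {S : EnrichedFunctor V K (EnrichedFunctor V A V)} (c : WeightedCone ψ (opFunctor S)) :
    (c.map (opFunctor (coyo V φ))).IsLimit ↔
      ∀ (Y X : V) (θ : ∀ k : Kᵒᵖ, (X ⊗ ψ.obj k) ⊗ (φ ⟶[V] S.obj k.unop) ⟶ Y),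
        (∀ j k : Kᵒᵖ, inCtx X (ract ψ j k) ▷ _ ≫ θ k =
          inCtx _ (S.map k.unop j.unop ▷ _ ≫ lcomp V φ _ _) ≫ θ j) →
        ∃! t : X ⊗ (φ ⟶[V] c.pt.unop) ⟶ Y, ∀ k : Kᵒᵖ,
          inCtx X (c.cocounit k ▷ _ ≫ lcomp V φ _ _) ≫ t = θ k := by
  let c' : WeightedCone ψ (opFunctor (S.comp V (coyo V φ))) := c.map (opFunctor (coyo V φ))
  have h₁ (k : Kᵒᵖ) : c'.cocounit k ▷ _ ≫ lev _ _ = c.cocounit k ▷ _ ≫ lcomp V φ _ _ := by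
    have : (c.cocounit k ≫ (coyo V φ).map (S.obj k.unop) c.pt.unop) ▷ (φ ⟶[V] S.obj k.unop) ≫
        lev _ _ = c.cocounit k ▷ _ ≫ lcomp V φ _ _ := by
      rw [comp_whiskerRight_assoc, coyo_map_lev]
    exact this
  have h₂ (j k : K) : (S.comp V (coyo V φ)).map j k ▷ _ ≫ lev _ _ =
      S.map j k ▷ _ ≫ lcomp V φ _ _ := by
    have : (S.map j k ≫ (coyo V φ).map (S.obj j) (S.obj k)) ▷ (φ ⟶[V] S.obj j) ≫
        lev _ _ = S.map j k ▷ _ ≫ lcomp V φ _ _ := by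
      rw [comp_whiskerRight_assoc, coyo_map_lev]
    exact this
  have h := c'.isColimit_self_iff
  simp only [h₁, h₂] at h
  exact h

/-- A cocone θ on the [A, V](φ, S k) is transposed to a cocone on S with vertex the dual functor of
Y. It factors through the colimit F, and the factorization is transposed back. Nuclearity is applied
to φ alone: the factor [A, V](φ, F) goes into the context and [A, V](φ, φ) is evaluated at the
identity. -/
theorem IsNuclear.preservesColimit (h : IsNuclear φ) (ψ : EnrichedFunctor V Kᵒᵖ V)
    (S : EnrichedFunctor V K (EnrichedFunctor V A V)) : PreservesColimit ψ S (coyo V φ) := by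
  intro c hc
  refine c.isColimit_map_coyo_iff.2 fun Y X θ hθ ↦ ?_
  let F : EnrichedFunctor V A V := c.pt.unop
  let a (k : Kᵒᵖ) : ψ.obj k ⊗ (φ ⟶[V] S.obj k.unop) ⟶ (φ ⟶[V] F) :=
    c.cocounit k ▷ _ ≫ lcomp V φ (S.obj k.unop) F
  have ha₁ (k : Kᵒᵖ) (b : A) : a k ▷ _ ≫ fev φ F b =
      inCtx _ (fev φ (S.obj k.unop) b) ≫ c.cocounit k ▷ _ ≫ fev _ _ b := by
    rw [comp_whiskerRight_assoc, lcomp_fev, reassoc_of% inCtx_naturality]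
  have ha₂ (k : Kᵒᵖ) (b : A) : (c.cocounit k ▷ _ ≫ fev _ _ b) ▷ _ ≫ yonedaComp φ F b =
      inCtx _ (yonedaComp φ (S.obj k.unop) b) ≫ a k := by
    rw [comp_whiskerRight_assoc, fev_yonedaComp, reassoc_of% inCtx_naturality]
  let q (k : Kᵒᵖ) (b : A) : ((X ⊗ ψ.obj k) ⊗ (S.obj k.unop).obj b) ⊗ (φ ⟶[V] coyo V b) ⟶ Y :=
    inCtx _ (yonedaComp φ (S.obj k.unop) b) ≫ θ k
  obtain ⟨x, hx, hu⟩ := c.isColimit_functor_iff.1 hc (dualFunctor φ Y) X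
    (fun k b ↦ lcurry (q k b))
    (fun k ↦ isLinear_lcurry φ (q k) fun i j ↦ by
      dsimp only [q]
      rw [reassoc_of% (inCtx_assoc _ (ract_yonedaComp φ (S.obj k.unop) i j))])
    (fun j k b ↦ lev_ext (by
      have e : (S.map k.unop j.unop ▷ _ ≫ fev _ _ b) ▷ _ ≫ yonedaComp φ (S.obj j.unop) b =
          inCtx _ (yonedaComp φ (S.obj k.unop) b) ≫ S.map k.unop j.unop ▷ _ ≫ lcomp V φ _ _ := by
        rw [comp_whiskerRight_assoc, fev_yonedaComp, reassoc_of% inCtx_naturality]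
      dsimp only [q]
      rw [comp_whiskerRight_assoc, comp_whiskerRight_assoc, lcurry_lev, lcurry_lev,
        reassoc_of% inCtx_naturality, hθ, reassoc_of% (inCtx_assoc _ e)]
      rfl))
  let p (b : A) : (X ⊗ F.obj b) ⊗ (φ ⟶[V] coyo V b) ⟶ Y :=
    (x ▷ _ ≫ fev F (dualFunctor φ Y) b) ▷ _ ≫ lev _ _
  have hp (j k : A) : inCtx X (ract F j k) ▷ _ ≫ p k =
      inCtx _ (yonedaComp φ (coyo V j) k) ≫ p j := by
    refine isLinear_lev φ (F := F) (m := fun b ↦ x ▷ _ ≫ fev F (dualFunctor φ Y) b)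
      (fun i j ↦ ?_) j k
    rw [comp_whiskerRight_assoc, fev_isLinear, reassoc_of% inCtx_naturality]
  have hpq (k : Kᵒᵖ) (b : A) : inCtx X (c.cocounit k ▷ _ ≫ fev _ _ b) ▷ _ ≫ p b = q k b := by
    have := congrArg (fun f ↦ f ▷ _ ≫ lev _ _) (hx k b)
    dsimp only at this
    rwa [comp_whiskerRight_assoc, lcurry_lev] at this
  have hpx (b : A) : p b = (x ▷ _ ≫ fev F (dualFunctor φ Y) b) ▷ _ ≫ lev _ _ := rfl
  clear_value p
  obtain ⟨t, ht, htu⟩ := h (X ⊗ (φ ⟶[V] F)) Y (fun b ↦ inCtx X (fev φ F b) ▷ _ ≫ p b)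
    fun j k ↦ by
      dsimp only
      rw [← reassoc_of% inCtx_naturality, ← hp, ← comp_whiskerRight_assoc,
        ← comp_whiskerRight_assoc,
        inCtx_assoc X (fev_isLinear φ F j k)]
  refine ⟨(ρ_ _).inv ≫ _ ◁ eId V φ ≫ t, fun k ↦ ?_, fun s hs ↦ ?_⟩
  -- By nuclearity it suffices to compare on products in [A, V](φ, φ), where `hpq` identifies the
  -- two sides.
  · have key : inCtx X (a k) ▷ _ ≫ t = inCtx _ (lcomp V φ φ (S.obj k.unop)) ≫ θ k := by
      refine (h ((X ⊗ ψ.obj k) ⊗ (φ ⟶[V] S.obj k.unop)) Y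
        (fun b ↦ inCtx _ (yonedaComp φ φ b) ≫ inCtx X (a k) ▷ _ ≫ t) fun i j ↦ ?_).unique
        (fun _ ↦ rfl) fun b ↦ ?_
      · rw [reassoc_of% (inCtx_assoc _ (ract_yonedaComp φ φ i j))]
      · rw [← reassoc_of% inCtx_naturality, ht, ← comp_whiskerRight_assoc, inCtx_assoc X (ha₁ k b),
          comp_whiskerRight_assoc, hpq,
          reassoc_of% (inCtx_assoc _ (fev_yonedaComp φ φ (S.obj k.unop) b))]
    rw [rightUnitor_inv_naturality_assoc, ← whisker_exchange_assoc, key,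
      reassoc_of% inCtx_whiskerRight, whiskerLeft_eId_lcomp, inCtx]
    simp
  -- Uniqueness: s restricted to products is balanced, and its transpose factors the same cocone on
  -- S. So it equals x, and s agrees with p on products.
  · have hl (i j : A) : inCtx X (ract F i j) ▷ _ ≫ inCtx X (yonedaComp φ F j) ≫ s =
        inCtx _ (yonedaComp φ (coyo V i) j) ≫ inCtx X (yonedaComp φ F i) ≫ s := by
      rw [reassoc_of% (inCtx_assoc X (ract_yonedaComp φ F i j))]
    have hy := hu (isLinear_lcurry φ (F := F) _ hl).lift fun k b ↦ by
      rw [IsLinear.lift_fev]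
      refine lev_ext ?_
      rw [comp_whiskerRight_assoc, lcurry_lev, lcurry_lev, reassoc_of% (inCtx_assoc X (ha₂ k b)),
        hs]
    have hp' (b : A) : p b = inCtx X (yonedaComp φ F b) ≫ s := by
      rw [hpx, ← hy, IsLinear.lift_fev, lcurry_lev]
    rw [← htu (inCtx X (lcomp V φ φ F) ≫ s) fun b ↦ ?_]
    · rw [reassoc_of% inCtx_whiskerRight, whiskerLeft_eId_lcomp, inCtx, Category.assoc,
        ← rightUnitor_tensor_hom_assoc, Iso.inv_hom_id_assoc]
    · rw [hp', reassoc_of% (inCtx_assoc X (fev_yonedaComp φ φ F b))]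

end SmallProjective

/-! ### The Yoneda embedding and the necessity of nuclearity -/

section Yoneda

variable {V : Type v} [Category.{w} V] [MonoidalCategory V] [SymmetricCategory V] [MonoidalClosed V]
  [HasLimits V]

section

variable {A : Type u₁} [EnrichedCategory V A] [IsSmall V A]

omit [SymmetricCategory V] [HasLimits V] [IsSmall V A] in
theorem ract_isLinear (F : EnrichedFunctor V A V) (a : A) :
    IsLinear (F := coyo V a) (ract F a) := fun j k ↦ by
  rw [ract_coyo, ract_ract]

/-- The Yoneda morphism `F a ⟶ [A, V](A(a, -), F)`. -/
def yonedaHom (F : EnrichedFunctor V A V) (a : A) : F.obj a ⟶ (coyo V a ⟶[V] F) :=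
  (ract_isLinear F a).lift

theorem yonedaHom_fev (F : EnrichedFunctor V A V) (a b : A) :
    yonedaHom F a ▷ _ ≫ fev (coyo V a) F b = ract F a b :=
  (ract_isLinear F a).lift_fev b

theorem ract_yonedaHom (F : EnrichedFunctor V A V) (j k : A) :
    ract F j k ≫ yonedaHom F k = (yonedaHom F j ⊗ₘ yonedaHom (coyo V j) k) ≫
      lcomp V (coyo V k) (coyo V j) F := by
  refine fev_ext fun c ↦ ?_
  rw [comp_whiskerRight_assoc, comp_whiskerRight_assoc, yonedaHom_fev, lcomp_fev,
    MonoidalCategory.tensorHom_def', comp_whiskerRight_assoc, reassoc_of% inCtx_naturality,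
    reassoc_of% inCtx_whiskerLeft, yonedaHom_fev, yonedaHom_fev, ract_coyo, ract_ract]

theorem yonedaHom_lcomp (φ F : EnrichedFunctor V A V) (a : A) :
    yonedaHom F a ▷ _ ≫ lcomp V φ (coyo V a) F = yonedaComp φ F a := by
  refine fev_ext fun c ↦ ?_
  rw [comp_whiskerRight_assoc, lcomp_fev, reassoc_of% inCtx_naturality, yonedaHom_fev,
    yonedaComp_fev]

theorem eId_yonedaHom (a : A) : eId V a ≫ yonedaHom (coyo V a) a = eId V (coyo V a) := by
  refine fev_ext fun c ↦ ?_
  rw [comp_whiskerRight_assoc, yonedaHom_fev, eId_fev, ract_coyo, ← cancel_epi (λ_ _).inv,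
    e_id_comp,
    Iso.inv_hom_id]

end

variable {B : Type u₁} [EnrichedCategory V B] [IsSmall V B]

variable (V B) in
/-- The Yoneda embedding. -/
abbrev yonedaFunctor : EnrichedFunctor V B (EnrichedFunctor V Bᵒᵖ V) where
  obj b := coyo V (Opposite.op b)
  map x y := yonedaHom (coyo V (Opposite.op y)) (Opposite.op x)
  map_id x := eId_yonedaHom (Opposite.op x)
  map_comp x y z := by
    have h := ract_yonedaHom (coyo V (Opposite.op z)) (Opposite.op y) (Opposite.op x)
    rw [ract_coyo, eComp_op_eq, Category.assoc, lcomp, braiding_naturality_assoc] at h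
    exact (cancel_epi _).1 h

/-- Every weight `φ` is the colimit `φ * Y` of the Yoneda embedding `Y`. -/
def yonedaCone (φ : EnrichedFunctor V Bᵒᵖ V) : WeightedCone φ (opFunctor (yonedaFunctor V B)) where
  pt := .op φ
  counit b := yonedaHom φ b
  naturality j k := ract_yonedaHom φ j k

/-- The co-Yoneda argument: a family on (X ⊗ φ k) ⊗ A(k, a), balanced in k and linear in a, is
determined by its values at identities. -/
theorem yonedaCone_isLimit (φ : EnrichedFunctor V Bᵒᵖ V) : (yonedaCone φ).IsLimit := by
  refine (yonedaCone φ).isColimit_functor_iff.2 fun G X m hl hm ↦ ?_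
  replace hm (j k a : Bᵒᵖ) :
      inCtx X (ract φ j k) ▷ _ ≫ m k a = inCtx _ (eComp V j k a) ≫ m j a := by
    have h := yonedaHom_fev (coyo V j) k a
    rw [ract_coyo] at h
    rw [← h]
    exact hm j k a
  replace hl (i j k : Bᵒᵖ) : m i j ▷ _ ≫ ract G j k = inCtx _ (eComp V i j k) ≫ m i k := by
    have h := hl i j k
    have h' : ract (((yonedaFunctor V B).obj i.unop)) j k = eComp V i j k := ract_coyo _ _ _
    rwa [h'] at h
  suffices H : ∃! x : X ⟶ (φ ⟶[V] G), ∀ k a, inCtx X (ract φ k a) ≫ x ▷ _ ≫ fev φ G a = m k a by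
    have h₁ (k a : Bᵒᵖ) : (yonedaCone φ).cocounit k ▷ _ ≫ fev _ _ a = ract φ k a :=
      yonedaHom_fev φ k a
    simp only [h₁]
    exact H
  let f (a : Bᵒᵖ) : X ⊗ φ.obj a ⟶ G.obj a := (ρ_ _).inv ≫ _ ◁ eId V a ≫ m a a
  have hf₁ (k a : Bᵒᵖ) : inCtx X (ract φ k a) ≫ f a = m k a := by
    have h : (k ⟶[V] a) ◁ eId V a ≫ eComp V k a a = (ρ_ _).hom := by
      rw [← cancel_epi (ρ_ _).inv, e_comp_id, Iso.inv_hom_id]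
    rw [rightUnitor_inv_naturality_assoc, ← whisker_exchange_assoc, hm,
      reassoc_of% inCtx_whiskerRight, h, inCtx, Category.assoc, ← rightUnitor_tensor_hom_assoc,
      Iso.inv_hom_id_assoc]
  have hf₂ (j k : Bᵒᵖ) : f j ▷ _ ≫ ract G j k = m j k := by
    have h : eId V j ▷ _ ≫ eComp V j j k = (λ_ _).hom := by
      rw [← cancel_epi (λ_ _).inv, e_id_comp, Iso.inv_hom_id]
    rw [comp_whiskerRight_assoc, comp_whiskerRight_assoc, hl, reassoc_of% inCtx_whiskerLeft, h,
      inCtx]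
    simp
  -- Balancedness (`hf₁`) and linearity of m (`hf₂`) express m j k through f in two ways; their
  -- agreement is linearity of f.
  have hf : IsLinear f := fun j k ↦ by rw [hf₁, hf₂]
  refine ⟨hf.lift, fun k a ↦ ?_, fun x hx ↦ fev_ext fun a ↦ ?_⟩
  · rw [hf.lift_fev, hf₁]
  · have h : φ.obj a ◁ eId V a ≫ ract φ a a = (ρ_ _).hom := by
      rw [ract, ← MonoidalClosed.uncurry_natural_left, φ.map_id]
      exact MonoidalClosed.uncurry_curry _
    rw [hf.lift_fev]
    dsimp only [f]
    rw [← hx a a, reassoc_of% inCtx_whiskerRight, h, inCtx, Category.assoc,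
      ← rightUnitor_tensor_hom_assoc, Iso.inv_hom_id_assoc]

/-- The image of the Yoneda cone under [A, V](φ, -) has the maps `yonedaComp` as its structure, so
its universal property is nuclearity itself. -/
theorem isNuclear_of_preservesColimit {φ : EnrichedFunctor V Bᵒᵖ V}
    (h : PreservesColimit φ (yonedaFunctor V B) (coyo V φ)) : IsNuclear φ := by
  intro X Y θ hθ
  have h₁ (j k : Bᵒᵖ) : (yonedaFunctor V B).map k.unop j.unop ▷ _ ≫ lcomp V φ _ _ =
      yonedaComp φ (coyo V j) k := yonedaHom_lcomp φ (coyo V j) k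
  have h₂ (k : Bᵒᵖ) : (yonedaCone φ).cocounit k ▷ _ ≫ lcomp V φ _ _ = yonedaComp φ φ k :=
    yonedaHom_lcomp φ φ k
  have H := (yonedaCone φ).isColimit_map_coyo_iff.1 (h _ (yonedaCone_isLimit φ)) Y X θ
  simp only [h₁, h₂] at H
  exact H hθ

end Yoneda

/-! ### Change of universe -/

section Lift

variable {V : Type v} [Category.{w} V] [MonoidalCategory V]

/-- The `V`-category structure on a type raised to a higher universe. -/
instance uliftEnrichedCategory {C : Type u₁} [EnrichedCategory V C] :
    EnrichedCategory V (ULift.{u₂} C) where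
  Hom x y := x.down ⟶[V] y.down
  id x := eId V x.down
  comp x y z := eComp V x.down y.down z.down
  id_comp _ _ := e_id_comp V _ _
  comp_id _ _ := e_comp_id V _ _
  assoc _ _ _ _ := e_assoc V _ _ _ _

variable {K : Type u} [EnrichedCategory V K] {C : Type u₁} [EnrichedCategory V C]
  {D : Type u₂} [EnrichedCategory V D]

/-- A `V`-functor with its target raised to a higher universe. -/
def liftTarget (S : EnrichedFunctor V K C) : EnrichedFunctor V K (ULift.{u₃} C) where
  obj k := ⟨S.obj k⟩
  map := S.map
  map_id := S.map_id
  map_comp := S.map_comp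

/-- A `V`-functor with its source and target raised to higher universes. -/
def liftFunctor (P : EnrichedFunctor V C D) : EnrichedFunctor V (ULift.{u₃} C) (ULift.{t} D) where
  obj x := ⟨P.obj x.down⟩
  map x y := P.map x.down y.down
  map_id x := P.map_id x.down
  map_comp x y z := P.map_comp x.down y.down z.down

/-- Lifting leaves all hom-objects unchanged, so both limit conditions agree definitionally. It lets
one universe of objects house both [Bᵒᵖ, V] and V. -/
theorem preservesColimit_of_lift [SymmetricCategory V] [MonoidalClosed V] [HasLimits V]
    [IsSmall V K] {φ : EnrichedFunctor V Kᵒᵖ V} {S : EnrichedFunctor V K C}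
    {P : EnrichedFunctor V C D}
    (h : PreservesColimit φ (liftTarget.{w, v, u, u₁, u₃} S)
      (liftFunctor.{w, v, t, u₁, u₂, u₃} P)) :
    PreservesColimit φ S P := by
  intro c hc
  let c' : WeightedCone φ (opFunctor (liftTarget.{w, v, u, u₁, u₃} S)) :=
    ⟨.op ⟨c.pt.unop⟩, c.counit, c.naturality⟩
  have hc' : c'.IsLimit := fun a ↦ hc (.op a.unop.down)
  exact fun a ↦ h c' hc' (.op ⟨a.unop⟩)

end Lift

end VCat

end

theorem mainTheorem5 {V : Type v} [Category.{w} V] [MonoidalCategory V]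
    [SymmetricCategory V] [MonoidalClosed V] [HasLimits V] [HasColimits V]
    {B : Type (max u w)} [EnrichedCategory V B] [VCat.IsSmall V B]
    (φ : EnrichedFunctor V Bᵒᵖ V) :
    (VCat.IsAbsoluteForLimits.{w, v, max u w, max t u v w} φ ↔ VCat.IsSmallProjective φ) ∧
      (VCat.IsAbsoluteForColimits.{w, v, max u w, max t u v w} φ ↔ VCat.IsSmallProjective φ) := by
  have h₁ (h : VCat.IsAbsoluteForColimits.{w, v, max u w, max t u v w} φ) : VCat.IsNuclear φ :=
    VCat.isNuclear_of_preservesColimit (VCat.preservesColimit_of_lift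
      (h (ULift.{max t u v w} (EnrichedFunctor V Bᵒᵖ V)) (ULift.{max t u v w} V) _ _))
  have h₂ (h : VCat.IsSmallProjective φ) : VCat.IsNuclear φ :=
    -- The test colimit is indexed by B itself and weighted by φ.
    VCat.isNuclear_of_preservesColimit (h B φ (VCat.yonedaFunctor V B))
  have h₃ (h : VCat.IsNuclear φ) : VCat.IsSmallProjective φ :=
    fun _ _ _ ψ S ↦ h.preservesColimit ψ S
  exact ⟨⟨fun h ↦ h₃ (h₁ h.isAbsoluteForColimits), fun h ↦ (h₂ h).isAbsoluteForLimits⟩,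
    ⟨fun h ↦ h₃ (h₁ h), fun h ↦ (h₂ h).isAbsoluteForLimits.isAbsoluteForColimits⟩⟩
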